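/- Let $\Omega\subset\mathbb{R}^D$ be a domain, i.e. a bounded connected open set, with Lipschitz boundary, let $\mathbf n$ be the outward unit normal of $\partial\Omega$ (at the boundary points where it exists), and let $J$ be a time interval with least element $t_0$, for instance $[t_0,\infty)$ or $[t_0,T)$. Let $\nu>0$ and $\lambda\ge 0$, and let $(\mathbf w,\mathbf u,q,r)$ be a classical solution on $J$, with body force $\mathbf g$, of the GePUP-ES formulation of the incompressible Navier–Stokes equations: $$\begin{aligned} \partial_t\mathbf w&=\mathbf g-r(t)\,\mathbf u\cdot\nabla\mathbf u-\nabla q+\nu\Delta\mathbf w &&\text{in }\Omega,\\ \mathbf w\cdot\boldsymbol\tau&=0 \ \text{ for all } \boldsymbol\tau\perp\mathbf n,\qquad \nabla\cdot\mathbf w=0&&\text{on }\partial\Omega,\\ \frac{\mathrm d r}{\mathrm d t}&=\int_\Omega(\mathbf u\cdot\nabla\mathbf u)\cdot\mathbf u\,\mathrm dV,\\ \mathbf u&=\mathscr P\mathbf w\ \text{ in }\Omega,\qquad \mathbf u\cdot\mathbf n=0\ \text{ on }\partial\Omega,\\ \Delta q&=\nabla\cdot(\mathbf g-r(t)\,\mathbf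 u\cdot\nabla\mathbf u)&&\text{in }\Omega,\\ \mathbf n\cdot\nabla q&=\mathbf n\cdot(\mathbf g-r(t)\,\mathbf u\cdot\nabla\mathbf u+\nu\Delta\mathbf w)+\lambda\,\mathbf n\cdot\mathbf w&&\text{on }\partial\Omega, \end{aligned}$$ with the initial condition $\mathbf w(\mathbf x,t_0)=\mathbf u(\mathbf x,t_0)$ for all $\mathbf x\in\overline\Omega$. Here $\mathbf u=\mathscr P\mathbf w$ (Leray–Helmholtz projection) means that $\nabla\cdot\mathbf u=0$ in $\Omega$ and $\mathbf w=\mathbf u+\nabla\phi$ in $\Omega$ for some scalar field $\phi(\cdot,t)$. Classical means: $\mathbf w,\mathbf u\in C^2(J\times\overline\Omega)$ and, for each $t\in J$, $\mathbf w(\cdot,t)\in C^3(\Omega)$, $q(\cdot,t)\in C^1(\overline\Omega)\cap C^2(\Omega)$ and $\mathbf g(\cdot,t)\in C^0(\overline\Omega)\cap C^1(\Omega)$. Suppose that $\mathbf g$ is conservative, i.e. for each $t\in J$ there is a scalar field $\varphi$ with $\mathbf g(\cdot,t)=-\nabla\varphi$ in $\Omega$. Then, for every $t\in J$ (with one-sided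 derivatives at endpoints of $J$), $$\frac{\mathrm d}{\mathrm d t}\Bigl(E_{\mathrm{kinetic}}+\frac{r^2}{2}\Bigr)=-\nu\|\nabla\mathbf u\|^2,$$ where $E_{\mathrm{kinetic}}=\frac12\int_\Omega\mathbf u\cdot\mathbf u\,\mathrm dV$ and $\|\nabla\mathbf u\|^2=\sum_{i=1}^D\sum_{j=1}^D\int_\Omega\bigl|\frac{\partial u_i}{\partial x_j}\bigr|^2\mathrm dV$. -/

import Mathlib

open MeasureTheory

noncomputable section

namespace GePUP

/-- Euclidean space `ℝ^D`. -/
abbrev Space (D : ℕ) : Type := EuclideanSpace ℝ (Fin D)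

/-! ### Domains and normals -/

/-- `Ω` is an open set with Lipschitz boundary: near each boundary point there are a unit direction
`e` and a Lipschitz function `γ` of the coordinates orthogonal to `e` such that `Ω` is the
region strictly below the graph of `γ`. -/
def HasLipschitzBoundary {D : ℕ} (Ω : Set (Space D)) : Prop :=
  ∀ x₀ ∈ frontier Ω, ∃ (e : Space D) (ρ : ℝ) (L : NNReal) (γ : Space D → ℝ),
    ‖e‖ = 1 ∧ 0 < ρ ∧ LipschitzWith L γ ∧ (∀ (y : Space D) (s : ℝ), γ (y + s • e) = γ y) ∧
      ∀ y ∈ Metric.ball x₀ ρ, y ∈ Ω ↔ inner ℝ y e < γ y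

/-- A domain: a bounded connected open subset of `ℝ^D`, with Lipschitz boundary. -/
structure IsLipschitzDomain {D : ℕ} (Ω : Set (Space D)) : Prop where
  isOpen : IsOpen Ω
  isConnected : IsConnected Ω
  isBounded : Bornology.IsBounded Ω
  lipschitz : HasLipschitzBoundary Ω

/-- `n` is the outward unit normal of `∂Ω` at the boundary point `x`: `Ω` has at `x` the tangent
half-space `{y | ⟪y - x, n⟫ < 0}`.  There is at most one such `n`; on a `C¹` boundary it exists at
every point and is the usual one, on a Lipschitz boundary (a polygon, say) it exists at almost
every point. -/
def IsOutwardUnitNormal {D : ℕ} (Ω : Set (Space D)) (x n : Space D) : Prop :=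
  x ∈ frontier Ω ∧ ‖n‖ = 1 ∧
    ∀ ε > (0 : ℝ), ∃ δ > (0 : ℝ), ∀ y ∈ Metric.ball x δ,
      (inner ℝ (y - x) n < -ε * ‖y - x‖ → y ∈ Ω) ∧
      (ε * ‖y - x‖ < inner ℝ (y - x) n → y ∉ Ω)

/-! ### Differential operators

Derivatives are taken within the closed set `closure Ω`: at points of `Ω` they are the ordinary
derivatives, at points of `∂Ω` they are, for functions that are smooth up to the boundary, their
continuous extensions. -/

/-- Gradient of a scalar field. -/
def grad {D : ℕ} (Ω : Set (Space D)) (f : Space D → ℝ) (x : Space D) : Space D :=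
  gradientWithin f (closure Ω) x

/-- The partial derivative `∂ v_i / ∂ x_j` of a vector field. -/
def partialDeriv {D : ℕ} (Ω : Set (Space D)) (v : Space D → Space D) (i j : Fin D)
    (x : Space D) : ℝ :=
  (fderivWithin ℝ v (closure Ω) x (EuclideanSpace.single j 1)) i

/-- Divergence of a vector field. -/
def divergence {D : ℕ} (Ω : Set (Space D)) (v : Space D → Space D) (x : Space D) : ℝ :=
  ∑ i, partialDeriv Ω v i i x

/-- Laplacian of a scalar or vector field. -/
def lap {D : ℕ} {F : Type*} [NormedAddCommGroup F] [NormedSpace ℝ F] (Ω : Set (Space D))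
    (f : Space D → F) (x : Space D) : F :=
  InnerProductSpace.laplacianWithin f (closure Ω) x

/-- The convection term `u · ∇u`, i.e. `(u · ∇u)_i = ∑ j, u_j ∂ u_i / ∂ x_j`. -/
def convection {D : ℕ} (Ω : Set (Space D)) (u : Space D → Space D) (x : Space D) : Space D :=
  fderivWithin ℝ u (closure Ω) x (u x)

/-! ### Integral quantities -/

/-- `I_cv(u, v) = ∫_Ω (u · ∇u) · v dV`. -/
def Icv {D : ℕ} (Ω : Set (Space D)) (u v : Space D → Space D) : ℝ :=
  ∫ x in Ω, inner ℝ (convection Ω u x) (v x)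

/-- The kinetic energy `½ ∫_Ω u · u dV`. -/
def kineticEnergy {D : ℕ} (Ω : Set (Space D)) (u : Space D → Space D) : ℝ :=
  (1 / 2) * ∫ x in Ω, inner ℝ (u x) (u x)

/-- `‖∇u‖² = ∑ i, ∑ j, ∫_Ω |∂ u_i / ∂ x_j|² dV`. -/
def gradNormSq {D : ℕ} (Ω : Set (Space D)) (u : Space D → Space D) : ℝ :=
  ∑ i, ∑ j, ∫ x in Ω, |partialDeriv Ω u i j x| ^ 2

/-! ### The Leray-Helmholtz projection and conservative forces -/

/-- `u = 𝒫 w` in `Ω`: `u` is the divergence-free part of a Helmholtz decomposition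
`w = u + ∇φ`.  (The decomposition is unique once the normal component of `u` on `∂Ω` is
prescribed.) -/
def IsLerayHelmholtzProjection {D : ℕ} (Ω : Set (Space D)) (w u : Space D → Space D) : Prop :=
  (∀ x ∈ Ω, divergence Ω u x = 0) ∧
    ∃ φ : Space D → ℝ, ∀ x ∈ Ω, HasGradientAt φ (w x - u x) x

/-- The force field `g` is conservative in `Ω`: `g = -∇ϕ` for a scalar field `ϕ`. -/
def IsConservative {D : ℕ} (Ω : Set (Space D)) (g : Space D → Space D) : Prop :=
  ∃ ϕ : Space D → ℝ, ∀ x ∈ Ω, HasGradientAt ϕ (-g x) x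

/-! ### The GePUP-ES formulation

`J` is the set of times, `g t x`, `w t x`, `u t x` are the body force and the two velocities,
`q t x` is the pressure-like scalar, `r t` the scalar auxiliary variable. -/

/-- The regularity under which all terms of the GePUP-ES formulation are classical. -/
structure IsClassical {D : ℕ} (Ω : Set (Space D)) (J : Set ℝ)
    (g w u : ℝ → Space D → Space D) (q : ℝ → Space D → ℝ) : Prop where
  w_reg : ContDiffOn ℝ 2 (fun p : ℝ × Space D => w p.1 p.2) (J ×ˢ closure Ω)
  w_interior : ∀ t ∈ J, ContDiffOn ℝ 3 (w t) Ω
  u_reg : ContDiffOn ℝ 2 (fun p : ℝ × Space D => u p.1 p.2) (J ×ˢ closure Ω)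
  q_reg : ∀ t ∈ J, ContDiffOn ℝ 1 (q t) (closure Ω)
  q_interior : ∀ t ∈ J, ContDiffOn ℝ 2 (q t) Ω
  g_reg : ∀ t ∈ J, ContinuousOn (g t) (closure Ω)
  g_interior : ∀ t ∈ J, ContDiffOn ℝ 1 (g t) Ω

/-- The GePUP-ES formulation of the incompressible Navier-Stokes equations on no-slip domains, with
viscosity `ν` and penalty parameter `lam`.  Time derivatives are taken within `J`. -/
structure IsGePUPES {D : ℕ} (Ω : Set (Space D)) (J : Set ℝ) (ν lam : ℝ)
    (g w u : ℝ → Space D → Space D) (q : ℝ → Space D → ℝ) (r : ℝ → ℝ) : Prop where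
  /-- `∂w/∂t = g - r u·∇u - ∇q + ν Δw` in `Ω` -/
  momentum : ∀ t ∈ J, ∀ x ∈ Ω,
    HasDerivWithinAt (fun s => w s x)
      (g t x - r t • convection Ω (u t) x - grad Ω (q t) x + ν • lap Ω (w t) x) J t
  /-- `w · τ = 0` on `∂Ω` for every tangent vector `τ` -/
  tangential : ∀ t ∈ J, ∀ x n τ : Space D, IsOutwardUnitNormal Ω x n →
    inner ℝ τ n = 0 → inner ℝ (w t x) τ = 0
  /-- `∇ · w = 0` on `∂Ω` -/
  div_boundary : ∀ t ∈ J, ∀ x ∈ frontier Ω, divergence Ω (w t) x = 0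
  /-- `dr/dt = I_cv(u, u)` -/
  sav : ∀ t ∈ J, HasDerivWithinAt r (Icv Ω (u t) (u t)) J t
  /-- `u = 𝒫 w` in `Ω` -/
  projection : ∀ t ∈ J, IsLerayHelmholtzProjection Ω (w t) (u t)
  /-- `u · n = 0` on `∂Ω` -/
  no_penetration : ∀ t ∈ J, ∀ x n : Space D, IsOutwardUnitNormal Ω x n → inner ℝ (u t x) n = 0
  /-- `Δq = ∇ · (g - r u·∇u)` in `Ω` -/
  pressure : ∀ t ∈ J, ∀ x ∈ Ω,
    lap Ω (q t) x = divergence Ω (fun y => g t y - r t • convection Ω (u t) y) x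
  /-- `n · ∇q = n · (g - r u·∇u + ν Δw) + lam n · w` on `∂Ω` -/
  pressure_boundary : ∀ t ∈ J, ∀ x n : Space D, IsOutwardUnitNormal Ω x n →
    inner ℝ n (grad Ω (q t) x) =
      inner ℝ n (g t x - r t • convection Ω (u t) x + ν • lap Ω (w t) x) +
        lam * inner ℝ n (w t x)

end GePUP

end

open MeasureTheory

noncomputable section

namespace GePUP

open Filter Topology Set
open scoped ContDiff

/-! The point is that `w = u` at all times and that `w` vanishes at every boundary point with a
normal. Then the momentum equation is an equation for `u`, and testing it with `u` gives the
balance: the convection term is cancelled by the derivative of `r²/2`, the gradient terms are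
orthogonal to `u`, and viscosity leaves `-ν‖∇u‖²`.

Three facts give `w = u`. Taking the divergence of the momentum equation and using the pressure
equation, `∇·w` solves the heat equation with zero initial and boundary values, so it vanishes by
the maximum principle (`heat_eq_zero`, `divergence_eq_zero`). At a boundary point with a normal, the
momentum equation extended by continuity and the pressure boundary condition give `(n·w)' = -λ n·w`,
with zero initial value; with the tangential condition, `w = 0` there
(`eq_zero_of_isOutwardUnitNormal`). Finally `w - u` is a gradient, solenoidal and tangent to the
boundary, hence orthogonal to itself (`w_eq_u`).

The analytic core is the divergence theorem `integral_flux_eq_zero` for `h v` with `v` tangent to a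
Lipschitz boundary. No surface integral enters: the field is cut off in a layer of thickness `δ`
below the boundary graph. The gradient of the cut-off has size `1/δ`, but its product with `v` stays
bounded because `v` is tangent and `C¹` (`IsGraphChart.abs_inner_le`), so the layer term tends to
zero by dominated convergence. Normals are needed only above almost every point, which Rademacher's
theorem for the graph function provides. -/

/-! ### Graph charts of a Lipschitz boundary -/

/-- In the ball of radius `ρ` about `x₀`, the set `Ω` is the region strictly below the graph, in
direction `e`, of the `L`-Lipschitz function `γ`. -/
structure IsGraphChart {D : ℕ} (Ω : Set (Space D)) (x₀ e : Space D) (ρ : ℝ) (L : NNReal)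
    (γ : Space D → ℝ) : Prop where
  norm_dir : ‖e‖ = 1
  radius_pos : 0 < ρ
  lip : LipschitzWith L γ
  invariant : ∀ (y : Space D) (s : ℝ), γ (y + s • e) = γ y
  mem_iff : ∀ y ∈ Metric.ball x₀ ρ, y ∈ Ω ↔ inner ℝ y e < γ y

namespace IsGraphChart

variable {D : ℕ} {Ω : Set (Space D)} {x₀ e : Space D} {ρ : ℝ} {L : NNReal} {γ : Space D → ℝ}

theorem inner_dir (h : IsGraphChart Ω x₀ e ρ L γ) : inner ℝ e e = 1 := by
  rw [real_inner_self_eq_norm_sq, h.norm_dir]; norm_num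

theorem sub_smul_mem (h : IsGraphChart Ω x₀ e ρ L γ) {x : Space D} {s : ℝ}
    (hx : x + s • e ∈ Metric.ball x₀ ρ) (hs : inner ℝ x e + s < γ x) : x + s • e ∈ Ω := by
  rw [h.mem_iff _ hx, h.invariant, inner_add_left, inner_smul_left, h.inner_dir]
  simpa using hs

theorem mem_frontier (h : IsGraphChart Ω x₀ e ρ L γ) {x : Space D}
    (hx : x ∈ Metric.ball x₀ ρ) (hxe : inner ℝ x e = γ x) : x ∈ frontier Ω := by
  have hnot : x ∉ Ω := fun hm => by
    have := (h.mem_iff x hx).1 hm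
    linarith
  refine ⟨?_, fun hi => hnot (interior_subset hi)⟩
  have hT : Tendsto (fun s : ℝ => x + s • e) (𝓝[<] 0) (𝓝 x) := by
    have : Continuous (fun s : ℝ => x + s • e) := by fun_prop
    have h0 := this.tendsto 0
    simp only [zero_smul, add_zero] at h0
    exact h0.mono_left nhdsWithin_le_nhds
  refine mem_closure_of_tendsto hT ?_
  filter_upwards [hT.eventually (Metric.isOpen_ball.mem_nhds hx), self_mem_nhdsWithin]
    with s hs hneg
  exact h.sub_smul_mem hs (by rw [hxe]; have : s < 0 := hneg; linarith)

theorem inner_eq_of_mem_frontier (h : IsGraphChart Ω x₀ e ρ L γ) (hΩ : IsOpen Ω) {x : Space D}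
    (hx : x ∈ Metric.ball x₀ ρ) (hf : x ∈ frontier Ω) : inner ℝ x e = γ x := by
  rw [hΩ.frontier_eq] at hf
  refine le_antisymm ?_ (not_lt.1 fun hlt => hf.2 ((h.mem_iff x hx).2 hlt))
  obtain ⟨y, hy, hyx⟩ := mem_closure_iff_seq_limit.1 hf.1
  have hc : Continuous (fun z : Space D => inner ℝ z e) := by fun_prop
  refine le_of_tendsto_of_tendsto ((hc.tendsto x).comp hyx)
    ((h.lip.continuous.tendsto x).comp hyx) ?_
  filter_upwards [hyx.eventually (Metric.isOpen_ball.mem_nhds hx)] with n hn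
  exact ((h.mem_iff _ hn).1 (hy n)).le

/-- Interior cone property. Since `γ` depends only on the component orthogonal to `e` and is
`L`-Lipschitz, the truncated open cone `C` with apex `x₀`, axis `-e` and slope `L` lies in `Ω`. It
is convex with nonempty interior and has `x₀` in its closure, which suffices for unique
differentiability. -/
theorem uniqueDiffWithinAt (h : IsGraphChart Ω x₀ e ρ L γ) (hΩ : IsOpen Ω)
    (hx : x₀ ∈ frontier Ω) : UniqueDiffWithinAt ℝ Ω x₀ := by
  have hball : x₀ ∈ Metric.ball x₀ ρ := Metric.mem_ball_self h.radius_pos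
  have hxe := h.inner_eq_of_mem_frontier hΩ hball hx
  let P : Space D →ₗ[ℝ] Space D := LinearMap.id - ((innerSL ℝ e).toLinearMap.smulRight e)
  have hP : ∀ z, P z = z - inner ℝ z e • e := fun z => by
    simp [P, real_inner_comm]
  have hPc : Continuous P := P.continuous_of_finiteDimensional
  let N : Space D → ℝ := fun z => L * ‖P (z - x₀)‖ + inner ℝ (z - x₀) e
  have hNc : Continuous N := by
    have : Continuous fun z => P (z - x₀) := hPc.comp (by fun_prop)
    fun_prop
  have hNconv : ConvexOn ℝ univ N := by
    refine ⟨convex_univ, fun a _ b _ s t hs ht hst => ?_⟩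
    have e1 : s • a + t • b - x₀ = s • (a - x₀) + t • (b - x₀) := by
      have : x₀ = s • x₀ + t • x₀ := by rw [← add_smul, hst, one_smul]
      nth_rewrite 1 [this]
      module
    simp only [N, e1, map_add, map_smul, inner_add_left, inner_smul_left, smul_eq_mul,
      conj_trivial]
    have := norm_add_le (s • P (a - x₀)) (t • P (b - x₀))
    rw [norm_smul, norm_smul, Real.norm_of_nonneg hs, Real.norm_of_nonneg ht] at this
    nlinarith [mul_le_mul_of_nonneg_left this L.2]
  let C : Set (Space D) := {z ∈ univ | N z < 0} ∩ Metric.ball x₀ ρ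
  have hCopen : IsOpen C := by
    refine IsOpen.inter ?_ Metric.isOpen_ball
    simpa using isOpen_lt hNc continuous_const
  have hCconv : Convex ℝ C := (hNconv.convex_lt 0).inter (convex_ball _ _)
  have hCsub : C ⊆ Ω := by
    rintro z ⟨⟨-, hz⟩, hzb⟩
    rw [h.mem_iff z hzb]
    have h1 : γ z = γ (x₀ + P (z - x₀)) := by
      rw [← h.invariant z (-inner ℝ (z - x₀) e), hP]
      congr 1
      module
    have h2 := h.lip.dist_le_mul (x₀ + P (z - x₀)) x₀
    rw [Real.dist_eq, dist_eq_norm, add_sub_cancel_left, ← h1] at h2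
    have h3 := (abs_le.1 h2).1
    have h4 : inner ℝ z e = inner ℝ x₀ e + inner ℝ (z - x₀) e := by
      rw [← inner_add_left, add_sub_cancel]
    have : L * ‖P (z - x₀)‖ + inner ℝ (z - x₀) e < 0 := hz
    linarith
  have hray : ∀ᶠ s : ℝ in 𝓝[<] 0, x₀ + s • e ∈ C := by
    have hcont : Continuous (fun s : ℝ => x₀ + s • e) := by fun_prop
    have hT : Tendsto (fun s : ℝ => x₀ + s • e) (𝓝[<] 0) (𝓝 x₀) := by
      have h0 := hcont.tendsto 0
      simp only [zero_smul, add_zero] at h0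
      exact h0.mono_left nhdsWithin_le_nhds
    filter_upwards [hT.eventually (Metric.isOpen_ball.mem_nhds hball), self_mem_nhdsWithin]
      with s hs hneg
    refine ⟨⟨mem_univ _, ?_⟩, hs⟩
    have : P (s • e) = 0 := by
      rw [hP, inner_smul_left, h.inner_dir]; simp
    simp only [N, add_sub_cancel_left, this, inner_smul_left, h.inner_dir]
    simpa using hneg
  have hne : C.Nonempty := by
    obtain ⟨s, hs⟩ := hray.exists
    exact ⟨_, hs⟩
  have hcl : x₀ ∈ closure C := by
    refine mem_closure_of_tendsto (f := fun s : ℝ => x₀ + s • e) (b := 𝓝[<] 0) ?_ hray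
    have hcont : Continuous (fun s : ℝ => x₀ + s • e) := by fun_prop
    have h0 := hcont.tendsto 0
    simp only [zero_smul, add_zero] at h0
    exact h0.mono_left nhdsWithin_le_nhds
  exact (uniqueDiffWithinAt_convex hCconv (by rwa [hCopen.interior_eq]) hcl).mono hCsub

/-- At a point of the graph where `γ` is differentiable, `e - ∇γ` is an outward normal. -/
theorem isOutwardUnitNormal (h : IsGraphChart Ω x₀ e ρ L γ) {x G : Space D}
    (hx : x ∈ Metric.ball x₀ ρ) (hxe : inner ℝ x e = γ x) (hG : HasGradientAt γ G x) :
    e - G ≠ 0 ∧ IsOutwardUnitNormal Ω x (‖e - G‖⁻¹ • (e - G)) := by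
  -- `γ` is constant along `e`, so its gradient is orthogonal to `e`; hence `e - G` has component
  -- `1` along `e` and cannot vanish.
  have hGe : inner ℝ G e = 0 := by
    have h1 : HasDerivAt (fun s : ℝ => γ (x + s • e)) (inner ℝ G e) 0 := by
      have hl : HasDerivAt (fun s : ℝ => x + s • e) e 0 := by
        simpa using ((hasDerivAt_id (0 : ℝ)).smul_const e).const_add x
      have hG' := hG.hasFDerivAt
      have := HasFDerivAt.comp_hasDerivAt (x := (0 : ℝ)) (f := fun s : ℝ => x + s • e)
        (l := γ) (l' := InnerProductSpace.toDual ℝ _ G) (by simpa using hG') hl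
      simpa [Function.comp_def] using this
    simp only [h.invariant] at h1
    exact h1.unique (hasDerivAt_const _ _)
  have hn1 : inner ℝ (e - G) e = 1 := by rw [inner_sub_left, h.inner_dir, hGe, sub_zero]
  have hne : e - G ≠ 0 := by
    intro h0; rw [h0, inner_zero_left] at hn1; norm_num at hn1
  have hnpos : 0 < ‖e - G‖ := norm_pos_iff.2 hne
  refine ⟨hne, h.mem_frontier hx hxe, ?_, fun ε hε => ?_⟩
  · rw [norm_smul, norm_inv, norm_norm, inv_mul_cancel₀ hnpos.ne']
  -- The tolerance is scaled by `‖e - G‖` because the normal is `e - G` divided by this norm.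
  · have hlo := (hasGradientAt_iff_isLittleO.1 hG).def (mul_pos hε hnpos)
    obtain ⟨δ, hδ, hball⟩ := Metric.eventually_nhds_iff_ball.1
      (hlo.and (Metric.isOpen_ball.mem_nhds hx))
    refine ⟨δ, hδ, fun y hy => ?_⟩
    obtain ⟨hy1, hy2⟩ := hball y hy
    rw [Real.norm_eq_abs, abs_le, ← hxe] at hy1
    have e1 : inner ℝ (y - x) (‖e - G‖⁻¹ • (e - G)) = ‖e - G‖⁻¹ *
        (inner ℝ y e - inner ℝ x e - inner ℝ G (y - x)) := by
      rw [inner_smul_right, inner_sub_right, inner_sub_left, real_inner_comm G]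
    rw [h.mem_iff y hy2, e1]
    have e2 : ∀ a : ℝ, a = ‖e - G‖⁻¹ * (‖e - G‖ * a) := fun a => by field_simp
    constructor
    · intro hlt
      rw [e2 (-ε * ‖y - x‖)] at hlt
      have := lt_of_mul_lt_mul_left hlt (by positivity)
      linarith [hy1.1]
    · intro hlt
      rw [e2 (ε * ‖y - x‖)] at hlt
      have := lt_of_mul_lt_mul_left hlt (by positivity)
      linarith [hy1.2]

end IsGraphChart

theorem IsLipschitzDomain.exists_chart {D : ℕ} {Ω : Set (Space D)} (hΩ : IsLipschitzDomain Ω)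
    {x : Space D} (hx : x ∈ frontier Ω) :
    ∃ (e : Space D) (ρ : ℝ) (L : NNReal) (γ : Space D → ℝ), IsGraphChart Ω x e ρ L γ := by
  obtain ⟨e, ρ, L, γ, h1, h2, h3, h4, h5⟩ := hΩ.lipschitz x hx
  exact ⟨e, ρ, L, γ, h1, h2, h3, h4, h5⟩

/-- This makes derivatives within `closure Ω` unambiguous at boundary points, so that regularity up
to the boundary passes to them. -/
theorem IsLipschitzDomain.uniqueDiffOn_closure {D : ℕ} {Ω : Set (Space D)}
    (hΩ : IsLipschitzDomain Ω) : UniqueDiffOn ℝ (closure Ω) := by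
  intro x hx
  by_cases hxΩ : x ∈ Ω
  · exact (hΩ.isOpen.uniqueDiffWithinAt hxΩ).mono subset_closure
  · have hf : x ∈ frontier Ω := by rw [hΩ.isOpen.frontier_eq]; exact ⟨hx, hxΩ⟩
    obtain ⟨e, ρ, L, γ, h⟩ := hΩ.exists_chart hf
    exact (h.uniqueDiffWithinAt hΩ.isOpen hf).mono subset_closure

theorem IsLipschitzDomain.isCompact_closure {D : ℕ} {Ω : Set (Space D)}
    (hΩ : IsLipschitzDomain Ω) : IsCompact (closure Ω) :=
  hΩ.isBounded.isCompact_closure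

variable {D : ℕ}

/-! ### The divergence at interior points -/

/-- The divergence of a vector field defined near the point under consideration. -/
def fdiv (v : Space D → Space D) (x : Space D) : ℝ :=
  ∑ i, (fderiv ℝ v x (EuclideanSpace.single i 1)) i

theorem closure_mem_nhds {Ω : Set (Space D)} (hΩ : IsOpen Ω) {x : Space D} (hx : x ∈ Ω) :
    closure Ω ∈ 𝓝 x :=
  mem_of_superset (hΩ.mem_nhds hx) subset_closure

theorem divergence_eq_fdiv {Ω : Set (Space D)} (hΩ : IsOpen Ω) (v : Space D → Space D)
    {x : Space D} (hx : x ∈ Ω) : divergence Ω v x = fdiv v x := by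
  simp only [divergence, partialDeriv, fdiv, fderivWithin_of_mem_nhds (closure_mem_nhds hΩ hx)]

theorem fdiv_congr {v v' : Space D → Space D} {x : Space D} (h : v =ᶠ[𝓝 x] v') :
    fdiv v x = fdiv v' x := by
  simp only [fdiv, h.fderiv_eq]

theorem abs_fdiv_le (v : Space D → Space D) (x : Space D) : |fdiv v x| ≤ D * ‖fderiv ℝ v x‖ := by
  refine (Finset.abs_sum_le_sum_abs _ _).trans ?_
  refine (Finset.sum_le_card_nsmul _ _ ‖fderiv ℝ v x‖ fun i _ => ?_).trans (by simp)
  refine (PiLp.norm_apply_le (fderiv ℝ v x (EuclideanSpace.single i 1)) i).trans ?_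
  simpa using (fderiv ℝ v x).le_opNorm (EuclideanSpace.single i 1)

theorem fdiv_smul {θ : Space D → ℝ} {T : Space D} {v : Space D → Space D} {x : Space D}
    (hθ : HasGradientAt θ T x) (hv : DifferentiableAt ℝ v x) :
    fdiv (fun y => θ y • v y) x = inner ℝ T (v x) + θ x * fdiv v x := by
  have h := hθ.hasFDerivAt.smul hv.hasFDerivAt
  have h' : fderiv ℝ (fun y => θ y • v y) x = _ := h.fderiv
  simp only [fdiv, h']
  simp [Finset.sum_add_distrib, Finset.mul_sum, PiLp.inner_apply, mul_comm, add_comm]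

theorem sum_inner_single_mul (T z : Space D) :
    ∑ i, inner ℝ T (EuclideanSpace.single i (1 : ℝ)) * z i = inner ℝ T z := by
  simp [PiLp.inner_apply, mul_comm]

/-! ### Integration by parts for fields of compact support -/

/-- The integrand is almost everywhere the divergence of `θ G`. Integration by parts for Lipschitz
functions, one coordinate at a time, moves the derivative from `θ` to `G`. Lipschitz regularity of
`θ` is the right generality because the cut-offs are built from the graph function `γ`. -/
theorem integral_inner_add_mul_fdiv_of_hasCompactSupport {θ : Space D → ℝ} {K : NNReal}
    (hθ : LipschitzWith K θ) {T : Space D → Space D} (hT : ∀ᵐ x, HasGradientAt θ (T x) x)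
    {G : Space D → Space D} (hG : ContDiff ℝ 1 G) (hGc : HasCompactSupport G) :
    ∫ x, (inner ℝ (T x) (G x) + θ x * fdiv G x) = 0 := by
  let b : Fin D → Space D := fun i => EuclideanSpace.single i 1
  have hGi : ∀ i, ContDiff ℝ 1 (fun x => G x i) := fun i => by fun_prop
  have hGic : ∀ i, HasCompactSupport (fun x => G x i) := fun i =>
    hGc.comp_left (g := fun z : Space D => z i) rfl
  have hfd : ∀ x i, fderiv ℝ (fun y => G y i) x (b i) = (fderiv ℝ G x (b i)) i := fun x i => by
    have h1 := (hG.differentiable (by simp) x).hasFDerivAt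
    have h2 := ((EuclideanSpace.proj (𝕜 := ℝ) i).hasFDerivAt (x := G x)).comp x h1
    have h3 : HasFDerivAt (fun y => G y i) _ x := h2
    rw [h3.fderiv]; rfl
  have hI1 : ∀ i, Integrable (fun x => lineDeriv ℝ θ x (b i) * G x i) := fun i =>
    (hθ.locallyIntegrable_lineDeriv (b i)).integrable_smul_right_of_hasCompactSupport
      (hGi i).continuous (hGic i)
  have hI2 : ∀ i, Integrable (fun x => θ x * (fderiv ℝ G x (b i)) i) := fun i => by
    simp_rw [← hfd]
    refine Continuous.integrable_of_hasCompactSupport ?_ ?_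
    · exact hθ.continuous.mul (((hGi i).continuous_fderiv (by simp)).clm_apply continuous_const)
    · exact ((hGic i).fderiv_apply ℝ (b i)).mul_left
  have key : ∀ i, ∫ x, (lineDeriv ℝ θ x (b i) * G x i + θ x * (fderiv ℝ G x (b i)) i) = 0 := by
    intro i
    obtain ⟨K', hK'⟩ := (hGi i).lipschitzWith_of_hasCompactSupport (hGic i) (by simp)
    have hl : ∀ x, lineDeriv ℝ (fun y => G y i) x (-b i) * θ x
        = -(θ x * (fderiv ℝ G x (b i)) i) := fun x => by
      rw [((hGi i).differentiable (by simp)).differentiableAt.lineDeriv_eq_fderiv, map_neg, hfd]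
      ring
    rw [integral_add (hI1 i) (hI2 i), hθ.integral_lineDeriv_mul_eq hK' (hGic i)]
    simp_rw [hl]
    rw [integral_neg, neg_add_cancel]
  have hsum : ∫ x, ∑ i, (lineDeriv ℝ θ x (b i) * G x i + θ x * (fderiv ℝ G x (b i)) i) = 0 := by
    refine (integral_finsetSum _ fun i _ => (hI1 i).add (hI2 i)).trans ?_
    exact Finset.sum_eq_zero fun i _ => key i
  rw [← hsum]
  refine integral_congr_ae ?_
  filter_upwards [hT] with x hx
  have hl : ∀ i, lineDeriv ℝ θ x (b i) = inner ℝ (T x) (b i) := fun i => by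
    rw [hx.hasFDerivAt.differentiableAt.lineDeriv_eq_fderiv, hx.hasFDerivAt.fderiv]; simp
  simp only [hl, Finset.sum_add_distrib, b, sum_inner_single_mul, fdiv, Finset.mul_sum]

/-- A smooth function of compact support in an open set, equal to one on a given compact set. -/
theorem exists_contDiff_one_on_compact {Ω K : Set (Space D)} (hΩ : IsOpen Ω) (hK : IsCompact K)
    (hKΩ : K ⊆ Ω) : ∃ κ : Space D → ℝ, ContDiff ℝ ∞ κ ∧ HasCompactSupport κ ∧ tsupport κ ⊆ Ω ∧
      ∀ x ∈ K, κ x = 1 := by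
  obtain ⟨L, hL, hKL, hLΩ⟩ := exists_compact_between hK hΩ hKΩ
  obtain ⟨κ, h1, h0, -⟩ := exists_contMDiffMap_one_nhds_of_subset_interior
    (n := ⊤) (modelWithCornersSelf ℝ (Space D)) hK.isClosed hKL
  have hsub : Function.support κ ⊆ L := fun x hx => by
    by_contra hxL; exact hx (h0 x hxL)
  exact ⟨κ, κ.contMDiff.contDiff, HasCompactSupport.of_support_subset_isCompact hL hsub,
    (closure_minimal hsub hL.isClosed).trans hLΩ, fun x hx => h1.self_of_nhdsSet x hx⟩

/-- `G` is controlled only on `Ω`, so it is replaced by `κ G`, with `κ` a bump function equal to one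
on `K`. The product with `θ` is unchanged on `Ω`, since `θ G` vanishes off `K`. -/
theorem integral_inner_add_mul_fdiv_of_compact {Ω K : Set (Space D)} (hΩ : IsOpen Ω)
    (hK : IsCompact K) (hKΩ : K ⊆ Ω) {θ : Space D → ℝ} {M : NNReal}
    (hθ : LipschitzWith M θ) {T : Space D → Space D} (hT : ∀ᵐ x, HasGradientAt θ (T x) x)
    {G : Space D → Space D} (hG : ContDiffOn ℝ 1 G Ω)
    (hzero : ∀ x ∈ Ω, x ∉ K → θ x • G x = 0) :
    ∫ x in Ω, (inner ℝ (T x) (G x) + θ x * fdiv G x) = 0 := by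
  obtain ⟨κ, hκ, hκc, hκΩ, hκ1⟩ := exists_contDiff_one_on_compact hΩ hK hKΩ
  have hGκ : ContDiff ℝ 1 (fun x => κ x • G x) := by
    rw [contDiff_iff_contDiffAt]
    intro x
    by_cases hx : x ∈ Ω
    · exact (ContDiff.contDiffAt (hκ.of_le (by simp))).smul (hG.contDiffAt (hΩ.mem_nhds hx))
    · have hx' : x ∉ tsupport κ := fun h => hx (hκΩ h)
      have : (fun x => κ x • G x) =ᶠ[𝓝 x] fun _ => 0 := by
        filter_upwards [(notMem_tsupport_iff_eventuallyEq.1 hx')] with y hy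
        simp [hy]
      exact contDiffAt_const.congr_of_eventuallyEq this
  have hGκc : HasCompactSupport (fun x => κ x • G x) := hκc.smul_right
  have h0 := integral_inner_add_mul_fdiv_of_hasCompactSupport hθ hT hGκ hGκc
  rw [← setIntegral_eq_integral_of_ae_compl_eq_zero (s := Ω)] at h0
  · rw [← h0]
    refine setIntegral_congr_ae hΩ.measurableSet ?_
    filter_upwards [hT] with x hx hxΩ
    -- Only the products `θ G` and `θ κ G` agree, not `G` and `κ G`; both integrands are therefore
    -- first written as divergences of products.
    rw [← fdiv_smul hx ((hG.contDiffAt (hΩ.mem_nhds hxΩ)).differentiableAt (by simp)),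
      ← fdiv_smul hx (hGκ.differentiable (by simp) x)]
    refine fdiv_congr ?_
    filter_upwards [hΩ.mem_nhds hxΩ] with y hy
    by_cases hyK : y ∈ K
    · rw [hκ1 y hyK, one_smul]
    · rw [smul_comm, hzero y hy hyK, smul_zero]
  · refine ae_of_all _ fun x hx => ?_
    have hx' : x ∉ tsupport κ := fun h => hx (hκΩ h)
    have hz : (fun x => κ x • G x) =ᶠ[𝓝 x] fun _ => 0 := by
      filter_upwards [(notMem_tsupport_iff_eventuallyEq.1 hx')] with y hy
      simp [hy]
    rw [fdiv_congr hz, hz.eq_of_nhds]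
    simp [fdiv]

/-! ### The cut-off profile -/

/-- Composed with depth divided by `δ`, the profile removes depths below `δ` and varies only between
`δ` and `2δ`. Its derivative is bounded because it is continuous on `[1, 2]` and zero elsewhere. -/
theorem exists_cutoff_profile : ∃ (ζ : ℝ → ℝ) (B : ℝ), ContDiff ℝ 1 ζ ∧ (∀ t ≤ 1, ζ t = 0) ∧
    (∀ t, 2 ≤ t → ζ t = 1) ∧ (∀ t, |ζ t| ≤ 1) ∧ (∀ t, |deriv ζ t| ≤ B) ∧
    (∀ t, t < 1 → deriv ζ t = 0) ∧ (∀ t, 2 < t → deriv ζ t = 0) := by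
  let ζ : ℝ → ℝ := fun t => Real.smoothTransition (t - 1)
  have hζ : ContDiff ℝ 1 ζ := Real.smoothTransition.contDiff.comp (contDiff_id.sub contDiff_const)
  have h0 : ∀ t ≤ 1, ζ t = 0 := fun t ht => Real.smoothTransition.zero_of_nonpos (by linarith)
  have h1 : ∀ t, 2 ≤ t → ζ t = 1 := fun t ht => Real.smoothTransition.one_of_one_le (by linarith)
  have hd0 : ∀ t, t < 1 → deriv ζ t = 0 := fun t ht => by
    have : ζ =ᶠ[𝓝 t] fun _ => 0 := by
      filter_upwards [Iio_mem_nhds ht] with s hs using h0 s (le_of_lt hs)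
    rw [this.deriv_eq, deriv_const]
  have hd1 : ∀ t, 2 < t → deriv ζ t = 0 := fun t ht => by
    have : ζ =ᶠ[𝓝 t] fun _ => 1 := by
      filter_upwards [Ioi_mem_nhds ht] with s hs using h1 s (le_of_lt hs)
    rw [this.deriv_eq, deriv_const]
  obtain ⟨B, hB⟩ := (isCompact_Icc (a := (1 : ℝ)) (b := 2)).exists_bound_of_continuousOn
    (hζ.continuous_deriv le_rfl).continuousOn
  refine ⟨ζ, max B 0, hζ, h0, h1, fun t => ?_, fun t => ?_, hd0, hd1⟩
  · rw [abs_of_nonneg (Real.smoothTransition.nonneg _)]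
    exact Real.smoothTransition.le_one _
  · by_cases ht1 : t < 1
    · simp [hd0 t ht1]
    · by_cases ht2 : 2 < t
      · simp [hd1 t ht2]
      · exact (hB t ⟨not_lt.1 ht1, not_lt.1 ht2⟩).trans (le_max_left _ _)

variable {Ω : Set (Space D)}

/-! ### Bounds for functions on a Lipschitz domain -/

theorem IsLipschitzDomain.isFiniteMeasure_restrict (hΩ : IsLipschitzDomain Ω) :
    IsFiniteMeasure (volume.restrict Ω) :=
  ⟨by simpa using hΩ.isBounded.measure_lt_top⟩

theorem IsLipschitzDomain.integrableOn_of_bounded {F : Type*} [NormedAddCommGroup F]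
    (hΩ : IsLipschitzDomain Ω) {f : Space D → F} (hf : ContinuousOn f Ω) {C : ℝ}
    (hC : ∀ x ∈ Ω, ‖f x‖ ≤ C) : IntegrableOn f Ω := by
  have := hΩ.isFiniteMeasure_restrict
  exact Integrable.of_bound (hf.aestronglyMeasurable hΩ.isOpen.measurableSet) C
    ((ae_restrict_iff' hΩ.isOpen.measurableSet).2 (ae_of_all _ hC))

theorem IsLipschitzDomain.integrableOn_of_continuousOn_closure {F : Type*} [NormedAddCommGroup F]
    (hΩ : IsLipschitzDomain Ω) {f : Space D → F} (hf : ContinuousOn f (closure Ω)) :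
    IntegrableOn f Ω := by
  obtain ⟨C, hC⟩ := hΩ.isCompact_closure.exists_bound_of_continuousOn hf
  exact hΩ.integrableOn_of_bounded (hf.mono subset_closure) fun x hx => hC x (subset_closure hx)

theorem contDiffOn_one_of_hasGradientAt (hΩ : IsOpen Ω) {k : Space D → ℝ}
    {k' : Space D → Space D} (hk : ∀ x ∈ Ω, HasGradientAt k (k' x) x)
    (hk' : ContinuousOn k' Ω) : ContDiffOn ℝ 1 k Ω := by
  rw [show (1 : WithTop ℕ∞) = 0 + 1 from rfl, contDiffOn_succ_iff_fderiv_of_isOpen hΩ]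
  refine ⟨fun x hx => (hk x hx).hasFDerivAt.differentiableAt.differentiableWithinAt, by simp, ?_⟩
  rw [contDiffOn_zero]
  refine ((InnerProductSpace.toDual ℝ (Space D)).continuous.comp_continuousOn hk').congr
    fun x hx => ?_
  exact (hk x hx).hasFDerivAt.fderiv

theorem continuousOn_fdiv (hΩ : IsOpen Ω) {v : Space D → Space D} (hv : ContDiffOn ℝ 1 v Ω) :
    ContinuousOn (fdiv v) Ω := by
  have h := hv.continuousOn_fderiv_of_isOpen hΩ le_rfl
  refine continuousOn_finsetSum _ fun i _ => ?_
  have h2 : ContinuousOn (fun x => fderiv ℝ v x (EuclideanSpace.single i 1)) Ω :=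
    h.clm_apply continuousOn_const
  fun_prop

/-- A `C¹` field up to the boundary is bounded, together with its derivative. -/
theorem IsLipschitzDomain.exists_bounds (hΩ : IsLipschitzDomain Ω) {v : Space D → Space D}
    (hv : ContDiffOn ℝ 1 v (closure Ω)) : ∃ M : ℝ, 0 ≤ M ∧ (∀ x ∈ closure Ω, ‖v x‖ ≤ M) ∧
      (∀ x ∈ closure Ω, ‖fderivWithin ℝ v (closure Ω) x‖ ≤ M) ∧ ∀ x ∈ Ω, |fdiv v x| ≤ D * M := by
  obtain ⟨A, hA⟩ := hΩ.isCompact_closure.exists_bound_of_continuousOn hv.continuousOn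
  obtain ⟨B, hB⟩ := hΩ.isCompact_closure.exists_bound_of_continuousOn
    (hv.continuousOn_fderivWithin hΩ.uniqueDiffOn_closure le_rfl)
  have hB' : ∀ x ∈ closure Ω, ‖fderivWithin ℝ v (closure Ω) x‖ ≤ max (max A B) 0 := fun x hx =>
    (hB x hx).trans ((le_max_right _ _).trans (le_max_left _ _))
  refine ⟨max (max A B) 0, le_max_right _ _, fun x hx => (hA x hx).trans
    ((le_max_left _ _).trans (le_max_left _ _)), hB', fun x hx => ?_⟩
  refine (abs_fdiv_le v x).trans ?_
  gcongr
  rw [← fderivWithin_of_mem_nhds (closure_mem_nhds hΩ.isOpen hx)]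
  exact hB' x (subset_closure hx)

/-! ### The flux of a field tangent to the boundary -/

/-- In a chart, a field tangent to the boundary is nearly orthogonal to `∇γ - e` close to the
boundary. -/
theorem IsGraphChart.abs_inner_le {x₀ e : Space D} {ρ : ℝ} {L : NNReal}
    {γ : Space D → ℝ} (h : IsGraphChart Ω x₀ e ρ L γ) {v : Space D → Space D}
    (hv : ContDiffOn ℝ 1 v (closure Ω))
    (hn : ∀ x n, IsOutwardUnitNormal Ω x n → inner ℝ (v x) n = 0) {M : ℝ}
    (hM : ∀ x ∈ closure Ω, ‖fderivWithin ℝ v (closure Ω) x‖ ≤ M) {x G : Space D}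
    (hG : HasGradientAt γ G x) (hx : x ∈ Metric.closedBall x₀ (ρ / 2)) {τ : ℝ} (hτ : 0 ≤ τ)
    (hτρ : τ < ρ / 2) (hτx : inner ℝ x e + τ = γ x) :
    |inner ℝ (G - e) (v x)| ≤ (L + 1) * (M * τ) := by
  have hxball : x ∈ Metric.ball x₀ ρ :=
    Metric.closedBall_subset_ball (by linarith [h.radius_pos]) hx
  have hx'ball : x + τ • e ∈ Metric.ball x₀ ρ := by
    rw [mem_ball_iff_norm]
    rw [mem_closedBall_iff_norm] at hx
    have h1 : x + τ • e - x₀ = (x - x₀) + τ • e := by abel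
    have h2 := norm_add_le (x - x₀) (τ • e)
    rw [norm_smul, h.norm_dir, Real.norm_of_nonneg hτ, mul_one] at h2
    rw [h1]; linarith
  have hx'e : inner ℝ (x + τ • e) e = γ (x + τ • e) := by
    rw [h.invariant, inner_add_left, inner_smul_left, h.inner_dir, ← hτx]; simp
  -- The comparison point `x + τ • e` lies on the boundary directly above `x`. Invariance of `γ`
  -- along `e` carries the gradient at `x` to that point, so the normal there is parallel to `e -
  -- G`.
  have hG' : HasGradientAt γ G (x + τ • e) := by
    have h1 : HasFDerivAt γ (InnerProductSpace.toDual ℝ _ G) (x + τ • e - τ • e) := by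
      simpa using hG.hasFDerivAt
    have h2 := h1.comp (x + τ • e) ((hasFDerivAt_id (x + τ • e)).sub_const (τ • e))
    have h3 : (γ ∘ fun y => id y - τ • e) = γ := by
      funext y
      have := h.invariant y (-τ)
      simpa [sub_eq_add_neg] using this
    rw [h3] at h2
    exact h2
  obtain ⟨hne, hnormal⟩ := h.isOutwardUnitNormal hx'ball hx'e hG'
  have hzero : inner ℝ (e - G) (v (x + τ • e)) = 0 := by
    have := hn _ _ hnormal
    rw [inner_smul_right] at this
    rw [real_inner_comm]
    exact (mul_eq_zero.1 this).resolve_left (inv_ne_zero (norm_ne_zero_iff.2 hne))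
  have hseg : segment ℝ x (x + τ • e) ⊆ closure Ω := by
    intro y hy
    have hyb : y ∈ Metric.ball x₀ ρ := (convex_ball x₀ ρ).segment_subset hxball hx'ball hy
    rw [segment_eq_image'] at hy
    obtain ⟨s, ⟨hs0, hs1⟩, rfl⟩ := hy
    have hy' : x + s • (x + τ • e - x) = x + (s * τ) • e := by
      rw [add_sub_cancel_left, smul_smul]
    simp only [hy'] at hyb ⊢
    rcases (mul_le_of_le_one_left hτ hs1).lt_or_eq with hlt | heq
    · exact subset_closure (h.sub_smul_mem hyb (by linarith))
    · rw [heq]; exact (h.mem_frontier hx'ball hx'e).1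
  -- The vertical segment stays in `closure Ω`, so the mean value inequality bounds the change of
  -- `v` from the boundary point, where its component along `e - G` is zero.
  have hlip : ‖v (x + τ • e) - v x‖ ≤ M * τ := by
    have := Convex.norm_image_sub_le_of_norm_hasFDerivWithin_le (f := v)
      (f' := fderivWithin ℝ v (closure Ω)) (s := segment ℝ x (x + τ • e)) (C := M)
      (fun y hy => ((hv.differentiableOn (by simp)) y (hseg hy)).hasFDerivWithinAt.mono hseg)
      (fun y hy => hM y (hseg hy)) (convex_segment _ _) (left_mem_segment ℝ _ _)
      (right_mem_segment ℝ _ _)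
    rwa [add_sub_cancel_left, norm_smul, h.norm_dir, Real.norm_of_nonneg hτ, mul_one] at this
  have hGn : ‖G - e‖ ≤ L + 1 := by
    refine (norm_sub_le _ _).trans ?_
    rw [h.norm_dir]
    have := norm_fderiv_le_of_lipschitz ℝ h.lip (x₀ := x)
    rw [hG.hasFDerivAt.fderiv, LinearIsometryEquiv.norm_map] at this
    linarith
  have heq : inner ℝ (G - e) (v x) = inner ℝ (e - G) (v (x + τ • e) - v x) := by
    rw [inner_sub_right, hzero, ← neg_sub e G, inner_neg_left]; ring
  rw [heq]
  refine (abs_real_inner_le_norm _ _).trans ?_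
  rw [norm_sub_rev e G]
  exact mul_le_mul hGn hlip (norm_nonneg _) (by positivity)

/-- With `τ` the vertical depth below the graph, `θ n` cuts off depths below `δ n`. The divergence
of `θ n k v` integrates to zero by the compact case. As `n → ∞` its integrand converges to `H`: the
layer term is eventually zero at each point and is bounded uniformly in `n`, the factor `1 / δ n`
being absorbed by the tangency of `v`. -/
theorem integral_flux_eq_zero_of_chart (hΩ : IsLipschitzDomain Ω) {x₀ e : Space D} {ρ : ℝ}
    {L : NNReal} {γ : Space D → ℝ} (h : IsGraphChart Ω x₀ e ρ L γ) {v : Space D → Space D}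
    (hv : ContDiffOn ℝ 1 v (closure Ω))
    (hn : ∀ x n, IsOutwardUnitNormal Ω x n → inner ℝ (v x) n = 0)
    {k : Space D → ℝ} {k' : Space D → Space D} (hk : ∀ x ∈ Ω, HasGradientAt k (k' x) x)
    (hk'c : ContinuousOn k' Ω) {C : ℝ} (hC : ∀ x ∈ Ω, |k x| ≤ C) (hC' : ∀ x ∈ Ω, ‖k' x‖ ≤ C)
    (hz : ∀ x ∈ Ω, x ∉ Metric.closedBall x₀ (ρ / 2) → k x = 0) :
    ∫ x in Ω, (inner ℝ (k' x) (v x) + k x * fdiv v x) = 0 := by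
  have hfin := hΩ.isFiniteMeasure_restrict
  have hms := hΩ.isOpen.measurableSet
  have hρ := h.radius_pos
  obtain ⟨ζ, B, hζ, hζ0, hζ1, hζle, hζB, hζd0, hζd1⟩ := exists_cutoff_profile
  obtain ⟨M, hM0, hMv, hMd, hMdiv⟩ := hΩ.exists_bounds hv
  have hvΩ : ContDiffOn ℝ 1 v Ω := hv.mono subset_closure
  have hkc : ContinuousOn k Ω := fun x hx => (hk x hx).hasFDerivAt.continuousAt.continuousWithinAt
  have hkd : ContDiffOn ℝ 1 k Ω := contDiffOn_one_of_hasGradientAt hΩ.isOpen hk hk'c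
  let H : Space D → ℝ := fun x => inner ℝ (k' x) (v x) + k x * fdiv v x
  have hHc : ContinuousOn H Ω :=
    (hk'c.inner hvΩ.continuousOn).add (hkc.mul (continuousOn_fdiv hΩ.isOpen hvΩ))
  have hHb : ∀ x ∈ Ω, |H x| ≤ C * M + C * (D * M) := fun x hx => by
    refine (abs_add_le _ _).trans (add_le_add ?_ ?_)
    · exact (abs_real_inner_le_norm _ _).trans (mul_le_mul (hC' x hx) (hMv x (subset_closure hx))
        (norm_nonneg _) ((norm_nonneg _).trans (hC' x hx)))
    · rw [abs_mul]
      exact mul_le_mul (hC x hx) (hMdiv x hx) (abs_nonneg _) ((abs_nonneg _).trans (hC x hx))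
  let τ : Space D → ℝ := fun x => γ x - inner ℝ x e
  have hτc : Continuous τ := h.lip.continuous.sub (by fun_prop)
  -- The factor `1/8` keeps the layer, whose depth is at most `2 δ n ≤ ρ / 4`, within the range `τ <
  -- ρ / 2` required by `abs_inner_le`.
  let δ : ℕ → ℝ := fun n => ρ / 8 * (1 / ((n : ℝ) + 1))
  have hδpos : ∀ n, 0 < δ n := fun n => by positivity
  have hδle : ∀ n, δ n ≤ ρ / 8 := fun n => by
    have : 1 / ((n : ℝ) + 1) ≤ 1 := by
      rw [div_le_one (by positivity)]; linarith [(Nat.cast_nonneg n : (0 : ℝ) ≤ n)]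
    exact mul_le_of_le_one_right (by positivity) this
  have hδlim : Tendsto δ atTop (𝓝 0) := by
    simpa [δ] using (tendsto_one_div_add_atTop_nhds_zero_nat (𝕜 := ℝ)).const_mul (ρ / 8)
  let θ : ℕ → Space D → ℝ := fun n x => ζ ((δ n)⁻¹ * τ x)
  let T : ℕ → Space D → Space D := fun n x =>
    (deriv ζ ((δ n)⁻¹ * τ x) * (δ n)⁻¹) • (gradient γ x - e)
  have hgrad : ∀ᵐ x, HasGradientAt γ (gradient γ x) x := by
    filter_upwards [h.lip.ae_differentiableAt] with x hx using hx.hasGradientAt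
  have hT : ∀ n, ∀ᵐ x, HasGradientAt (θ n) (T n x) x := fun n => by
    filter_upwards [hgrad] with x hx
    have h1 : HasFDerivAt (fun y : Space D => inner ℝ y e)
        (InnerProductSpace.toDual ℝ (Space D) e) x := by
      have := (InnerProductSpace.toDual ℝ (Space D) e).hasFDerivAt (x := x)
      refine this.congr_of_eventuallyEq (Eventually.of_forall fun y => ?_)
      simp [real_inner_comm]
    have h2 := (hx.hasFDerivAt.sub h1).const_mul (δ n)⁻¹
    have h3 := ((hζ.differentiable (by simp) ((δ n)⁻¹ * τ x)).hasDerivAt).comp_hasFDerivAt x h2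
    rw [hasGradientAt_iff_hasFDerivAt]
    refine h3.congr_fderiv ?_
    simp only [T, map_smul, map_sub, smul_smul]
  have hlip : ∀ n, ∃ K, LipschitzWith K (θ n) := fun n => by
    have h1 : LipschitzWith B.toNNReal ζ := by
      refine lipschitzWith_of_nnnorm_deriv_le (hζ.differentiable (by simp)) fun t => ?_
      rw [← NNReal.coe_le_coe, coe_nnnorm]
      exact (hζB t).trans (Real.le_coe_toNNReal B)
    have h2 := h.lip.sub ((innerSL ℝ e).lipschitz)
    have h3 := h1.comp ((ContinuousLinearMap.mul ℝ ℝ (δ n)⁻¹).lipschitz.comp h2)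
    have h4 : (ζ ∘ ContinuousLinearMap.mul ℝ ℝ (δ n)⁻¹ ∘ fun x => γ x - innerSL ℝ e x) = θ n := by
      funext x
      simp [θ, τ, real_inner_comm]
    exact ⟨_, h4 ▸ h3⟩
  have hint : ∀ n, ∫ x in Ω, (inner ℝ (T n x) (k x • v x) + θ n x * H x) = 0 := fun n => by
    obtain ⟨K, hK⟩ := hlip n
    let S : Set (Space D) := Metric.closedBall x₀ (ρ / 2) ∩ {x | δ n ≤ τ x}
    have hS : IsCompact S :=
      (isCompact_closedBall _ _).inter_right (isClosed_le continuous_const hτc)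
    have hSΩ : S ⊆ Ω := fun x hx => by
      rw [h.mem_iff x (Metric.closedBall_subset_ball (by linarith) hx.1)]
      have : δ n ≤ γ x - inner ℝ x e := hx.2
      linarith [hδpos n]
    rw [← integral_inner_add_mul_fdiv_of_compact hΩ.isOpen hS hSΩ hK (hT n) (hkd.smul hvΩ)]
    · refine setIntegral_congr_fun hms fun x hx => ?_
      have := fdiv_smul (hk x hx) ((hvΩ.contDiffAt (hΩ.isOpen.mem_nhds hx)).differentiableAt
        (by simp))
      simp only [H, ← this]
      rfl
    · intro x hx hxS
      by_cases hxb : x ∈ Metric.closedBall x₀ (ρ / 2)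
      · have hlt : τ x < δ n := not_le.1 fun hle => hxS ⟨hxb, hle⟩
        have : θ n x = 0 := by
          refine hζ0 _ ?_
          rw [inv_mul_le_iff₀ (hδpos n)]; linarith
        rw [this, zero_smul]
      · simp [hz x hx hxb]
  -- Where `ζ'` can be nonzero the depth is between `δ n` and `2 δ n`, so `|(∇γ - e)·v| ≤ (L + 1) M
  -- · 2 δ n`, which cancels the factor `(δ n)⁻¹`.
  have hcorr : ∀ n, ∀ᵐ x ∂volume.restrict Ω,
      |inner ℝ (T n x) (k x • v x)| ≤ C * (B * (2 * ((L + 1) * M))) := fun n => by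
    rw [ae_restrict_iff' hms]
    filter_upwards [hgrad] with x hx hxΩ
    have hC0 : 0 ≤ C := (abs_nonneg _).trans (hC x hxΩ)
    have hB0 : 0 ≤ B := (abs_nonneg _).trans (hζB 0)
    have hpos : 0 ≤ C * (B * (2 * ((L + 1) * M))) := by positivity
    by_cases hxb : x ∈ Metric.closedBall x₀ (ρ / 2)
    · by_cases h1 : (δ n)⁻¹ * τ x < 1
      · simpa [T, hζd0 _ h1] using hpos
      by_cases h2 : 2 < (δ n)⁻¹ * τ x
      · simpa [T, hζd1 _ h2] using hpos
      have h1' : δ n ≤ τ x := by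
        rw [not_lt, le_inv_mul_iff₀ (hδpos n)] at h1; linarith
      have h2' : τ x ≤ 2 * δ n := by
        rw [not_lt, inv_mul_le_iff₀ (hδpos n)] at h2; linarith
      have key := h.abs_inner_le hv hn hMd hx hxb (τ := τ x) (by linarith [hδpos n])
        (by linarith [hδle n]) (by simp [τ])
      have e1 : inner ℝ (T n x) (k x • v x) = k x * (deriv ζ ((δ n)⁻¹ * τ x) *
          ((δ n)⁻¹ * inner ℝ (gradient γ x - e) (v x))) := by
        simp only [T, inner_smul_left, inner_smul_right, conj_trivial]; ring
      have e2 : |(δ n)⁻¹ * inner ℝ (gradient γ x - e) (v x)| ≤ 2 * ((L + 1) * M) := by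
        rw [abs_mul, abs_of_pos (inv_pos.2 (hδpos n)), inv_mul_le_iff₀ (hδpos n)]
        refine key.trans ?_
        have : ((L : ℝ) + 1) * (M * τ x) ≤ (L + 1) * (M * (2 * δ n)) := by gcongr
        linarith
      rw [e1, abs_mul, abs_mul]
      exact mul_le_mul (hC x hxΩ) (mul_le_mul (hζB _) e2 (abs_nonneg _) hB0)
        (by positivity) hC0
    · simpa [hz x hxΩ hxb] using hpos
  have hlimit : Tendsto (fun n => ∫ x in Ω, (inner ℝ (T n x) (k x • v x) + θ n x * H x)) atTop
      (𝓝 (∫ x in Ω, H x)) := by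
    refine tendsto_integral_of_dominated_convergence
      (fun _ => C * (B * (2 * ((L + 1) * M))) + (C * M + C * (D * M))) (fun n => ?_)
      (integrable_const _) (fun n => ?_) ?_
    · refine AEStronglyMeasurable.add ?_ ?_
      · have hTm : Measurable (T n) := by
          have hg : Measurable (gradient γ) :=
            (InnerProductSpace.toDual ℝ (Space D)).symm.continuous.measurable.comp
              (measurable_fderiv ℝ γ)
          have hs : Measurable fun x => deriv ζ ((δ n)⁻¹ * τ x) * (δ n)⁻¹ := by
            have : Continuous fun x => deriv ζ ((δ n)⁻¹ * τ x) :=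
              (hζ.continuous_deriv le_rfl).comp (continuous_const.mul hτc)
            exact (this.mul continuous_const).measurable
          exact hs.smul (hg.sub_const e)
        exact hTm.aestronglyMeasurable.inner
          ((hkc.smul hvΩ.continuousOn).aestronglyMeasurable hms)
      · have hθc : Continuous (θ n) := hζ.continuous.comp (continuous_const.mul hτc)
        exact (hθc.continuousOn.mul hHc).aestronglyMeasurable hms
    · filter_upwards [hcorr n, ae_restrict_mem hms] with x hx hxΩ
      refine (norm_add_le _ _).trans (add_le_add hx ?_)
      rw [norm_mul]
      have := mul_le_mul (hζle ((δ n)⁻¹ * τ x)) (hHb x hxΩ) (abs_nonneg _) zero_le_one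
      simpa using this
    · filter_upwards [ae_restrict_mem hms] with x hxΩ
      by_cases hxb : x ∈ Metric.closedBall x₀ (ρ / 2)
      · have hτx : 0 < τ x := by
          have := (h.mem_iff x (Metric.closedBall_subset_ball (by linarith) hxb)).1 hxΩ
          simp only [τ]; linarith
        have hev : ∀ᶠ n in atTop, inner ℝ (T n x) (k x • v x) + θ n x * H x = H x := by
          filter_upwards [hδlim.eventually (Iio_mem_nhds (half_pos hτx))] with n hn'
          have hlt : 2 < (δ n)⁻¹ * τ x := by
            rw [lt_inv_mul_iff₀ (hδpos n)]
            have : δ n < τ x / 2 := hn'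
            linarith
          simp [T, θ, hζd1 _ hlt, hζ1 _ hlt.le]
        exact tendsto_const_nhds.congr' (hev.mono fun n hn' => hn'.symm)
      -- Outside the closed ball `k` vanishes on a neighbourhood, so its gradient vanishes too and
      -- the integrand is zero for every `n`.
      · have hk0 : k =ᶠ[𝓝 x] fun _ => 0 := by
          filter_upwards [hΩ.isOpen.mem_nhds hxΩ,
            Metric.isClosed_closedBall.isOpen_compl.mem_nhds hxb] with y hy hyb using hz y hy hyb
        have hk'0 : k' x = 0 := by
          have h1 := (hk x hxΩ).hasFDerivAt.congr_of_eventuallyEq hk0.symm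
          have h2 := h1.unique (hasFDerivAt_const (0 : ℝ) x)
          simpa using h2
        have hk00 : k x = 0 := hk0.eq_of_nhds
        simp [H, hk'0, hk00]
  simp only [hint] at hlimit
  exact (tendsto_nhds_unique hlimit tendsto_const_nhds)

/-- Apply the previous integration by parts to the field `k v` with the constant `θ = 1`, whose
gradient is zero. -/
theorem integral_flux_eq_zero_of_compact (hΩ : IsOpen Ω) {K : Set (Space D)} (hK : IsCompact K)
    (hKΩ : K ⊆ Ω) {v : Space D → Space D} (hv : ContDiffOn ℝ 1 v Ω)
    {k : Space D → ℝ} {k' : Space D → Space D} (hk : ∀ x ∈ Ω, HasGradientAt k (k' x) x)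
    (hk'c : ContinuousOn k' Ω) (hz : ∀ x ∈ Ω, x ∉ K → k x = 0) :
    ∫ x in Ω, (inner ℝ (k' x) (v x) + k x * fdiv v x) = 0 := by
  have hkd := contDiffOn_one_of_hasGradientAt hΩ hk hk'c
  have h1 : LipschitzWith 0 (fun _ : Space D => (1 : ℝ)) := LipschitzWith.const 1
  rw [← integral_inner_add_mul_fdiv_of_compact hΩ hK hKΩ h1 (T := fun _ => 0)
    (ae_of_all _ fun x => hasGradientAt_const x 1) (hkd.smul hv)]
  · refine setIntegral_congr_fun hΩ.measurableSet fun x hx => ?_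
    have := fdiv_smul (hk x hx) ((hv.contDiffAt (hΩ.mem_nhds hx)).differentiableAt (by simp))
    simp only [← this, inner_zero_left, zero_add, one_mul]
    rfl
  · intro x hx hxK
    simp [hz x hx hxK]

/-- A smooth finite partition of unity near `closure Ω`, one function being supported in `Ω` and
the others in small balls about boundary points. -/
theorem IsLipschitzDomain.exists_partition (hΩ : IsLipschitzDomain Ω)
    (ρ : Space D → ℝ) (hρ : ∀ x ∈ frontier Ω, 0 < ρ x) :
    ∃ (s : Finset (Space D)) (χ : Option s → Space D → ℝ), (∀ x ∈ s, x ∈ frontier Ω) ∧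
      (∀ i, ContDiff ℝ ∞ (χ i)) ∧ tsupport (χ none) ⊆ Ω ∧
      (∀ x : s, tsupport (χ (some x)) ⊆ Metric.ball x (ρ x)) ∧
      ∀ x ∈ closure Ω, ∑ i, χ i x = 1 := by
  have hcomp : IsCompact (frontier Ω) :=
    hΩ.isCompact_closure.of_isClosed_subset isClosed_frontier frontier_subset_closure
  obtain ⟨s, hs, hcov⟩ := hcomp.elim_nhds_subcover (fun x => Metric.ball x (ρ x))
    fun x hx => Metric.ball_mem_nhds x (hρ x hx)
  let U : Option s → Set (Space D) := fun i => i.elim Ω fun x => Metric.ball x (ρ x)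
  have hUo : ∀ i, IsOpen (U i) := by
    rintro (_ | x)
    · exact hΩ.isOpen
    · exact Metric.isOpen_ball
  have hUc : closure Ω ⊆ ⋃ i, U i := fun x hx => by
    by_cases hxΩ : x ∈ Ω
    · exact mem_iUnion.2 ⟨none, hxΩ⟩
    · have hf : x ∈ frontier Ω := by rw [hΩ.isOpen.frontier_eq]; exact ⟨hx, hxΩ⟩
      obtain ⟨y, hy, hxy⟩ := mem_iUnion₂.1 (hcov hf)
      exact mem_iUnion.2 ⟨some ⟨y, hy⟩, hxy⟩
  obtain ⟨f, hf⟩ := SmoothPartitionOfUnity.exists_isSubordinate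
    (modelWithCornersSelf ℝ (Space D)) isClosed_closure U hUo hUc
  refine ⟨s, fun i => f i, hs, fun i => (f i).contMDiff.contDiff, hf none, fun x => hf (some x),
    fun x hx => ?_⟩
  rw [← f.sum_eq_one hx, finsum_eq_sum_of_fintype]

/-- **Divergence theorem** on a Lipschitz domain for a field `h v` with `v` tangent to the
boundary. -/
theorem integral_flux_eq_zero (hΩ : IsLipschitzDomain Ω) {v : Space D → Space D}
    (hv : ContDiffOn ℝ 1 v (closure Ω))
    (hn : ∀ x n, IsOutwardUnitNormal Ω x n → inner ℝ (v x) n = 0)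
    {h : Space D → ℝ} {h' : Space D → Space D} (hh : ∀ x ∈ Ω, HasGradientAt h (h' x) x)
    (hh'c : ContinuousOn h' Ω) {C : ℝ} (hC : ∀ x ∈ Ω, |h x| ≤ C) (hC' : ∀ x ∈ Ω, ‖h' x‖ ≤ C) :
    ∫ x in Ω, (inner ℝ (h' x) (v x) + h x * divergence Ω v x) = 0 := by
  have hms := hΩ.isOpen.measurableSet
  have hex : ∀ x, ∃ ρ : ℝ, x ∈ frontier Ω → 0 < ρ ∧ ∃ (e : Space D) (L : NNReal)
      (γ : Space D → ℝ), IsGraphChart Ω x e ρ L γ := fun x => by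
    by_cases hx : x ∈ frontier Ω
    · obtain ⟨e, ρ, L, γ, hc⟩ := hΩ.exists_chart hx
      exact ⟨ρ, fun _ => ⟨hc.radius_pos, e, L, γ, hc⟩⟩
    · exact ⟨0, fun h => absurd h hx⟩
  choose ρ hρ using hex
  -- The radii are halved because the chart version asks the scalar factor to vanish outside the
  -- closed ball of radius `ρ / 2`.
  obtain ⟨s, χ, hs, hχ, hχ0, hχs, hχ1⟩ := hΩ.exists_partition (fun x => ρ x / 2)
    fun x hx => half_pos (hρ x hx).1
  have hvΩ : ContDiffOn ℝ 1 v Ω := hv.mono subset_closure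
  obtain ⟨M, hM0, hMv, -, hMdiv⟩ := hΩ.exists_bounds hv
  have hhc : ContinuousOn h Ω := fun x hx => (hh x hx).hasFDerivAt.continuousAt.continuousWithinAt
  let g : Option s → Space D → Space D := fun i => gradient (χ i)
  have hg : ∀ i x, HasGradientAt (χ i) (g i x) x := fun i x =>
    ((hχ i).differentiable (by simp) x).hasGradientAt
  have hgc : ∀ i, Continuous (g i) := fun i =>
    (InnerProductSpace.toDual ℝ (Space D)).symm.continuous.comp
      ((hχ i).continuous_fderiv (by simp))
  let k : Option s → Space D → ℝ := fun i x => χ i x * h x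
  let k' : Option s → Space D → Space D := fun i x => χ i x • h' x + h x • g i x
  have hk : ∀ i, ∀ x ∈ Ω, HasGradientAt (k i) (k' i x) x := fun i x hx => by
    rw [hasGradientAt_iff_hasFDerivAt]
    refine ((hg i x).hasFDerivAt.mul (hh x hx).hasFDerivAt).congr_fderiv ?_
    simp [k']
  have hk'c : ∀ i, ContinuousOn (k' i) Ω := fun i =>
    ((hχ i).continuous.continuousOn.smul hh'c).add (hhc.smul (hgc i).continuousOn)
  have hkc : ∀ i, ContinuousOn (k i) Ω := fun i => (hχ i).continuous.continuousOn.mul hhc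
  have hbound : ∀ i, ∃ B, (∀ x ∈ Ω, |k i x| ≤ B) ∧ ∀ x ∈ Ω, ‖k' i x‖ ≤ B := fun i => by
    obtain ⟨A, hA⟩ := hΩ.isCompact_closure.exists_bound_of_continuousOn
      (hχ i).continuous.continuousOn
    obtain ⟨A', hA'⟩ := hΩ.isCompact_closure.exists_bound_of_continuousOn
      (hgc i).continuousOn
    have hb1 : ∀ x ∈ Ω, |k i x| ≤ A * C := fun x hx => by
      rw [abs_mul]
      exact mul_le_mul (hA x (subset_closure hx)) (hC x hx) (abs_nonneg _)
        ((norm_nonneg _).trans (hA x (subset_closure hx)))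
    have hb2 : ∀ x ∈ Ω, ‖k' i x‖ ≤ A * C + C * A' := fun x hx => by
      refine (norm_add_le _ _).trans (add_le_add ?_ ?_)
      · rw [norm_smul]
        exact mul_le_mul (hA x (subset_closure hx)) (hC' x hx) (norm_nonneg _)
          ((norm_nonneg _).trans (hA x (subset_closure hx)))
      · rw [norm_smul]
        exact mul_le_mul (hC x hx) (hA' x (subset_closure hx)) (norm_nonneg _)
          ((abs_nonneg _).trans (hC x hx))
    exact ⟨max (A * C) (A * C + C * A'), fun x hx => (hb1 x hx).trans (le_max_left _ _),
      fun x hx => (hb2 x hx).trans (le_max_right _ _)⟩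
  have hpiece : ∀ i, ∫ x in Ω, (inner ℝ (k' i x) (v x) + k i x * fdiv v x) = 0 := by
    rintro (_ | x)
    · refine integral_flux_eq_zero_of_compact hΩ.isOpen (K := tsupport (χ none)) ?_ hχ0 hvΩ
        (hk none) (hk'c none) fun x _ hx => ?_
      · exact hΩ.isCompact_closure.of_isClosed_subset (isClosed_tsupport _)
          (hχ0.trans subset_closure)
      · simp [k, image_eq_zero_of_notMem_tsupport hx]
    · obtain ⟨-, e, L, γ, hc⟩ := hρ x (hs x x.2)
      obtain ⟨B, hB, hB'⟩ := hbound (some x)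
      refine integral_flux_eq_zero_of_chart hΩ hc hv hn (hk _) (hk'c _) hB hB' fun y _ hy => ?_
      have : y ∉ tsupport (χ (some x)) := fun hm => hy (Metric.ball_subset_closedBall (hχs x hm))
      simp [k, image_eq_zero_of_notMem_tsupport this]
  have hint : ∀ i, IntegrableOn (fun x => inner ℝ (k' i x) (v x) + k i x * fdiv v x) Ω := by
    intro i
    obtain ⟨B, hB, hB'⟩ := hbound i
    refine hΩ.integrableOn_of_bounded (C := B * M + B * (D * M))
      (((hk'c i).inner hvΩ.continuousOn).add ((hkc i).mul (continuousOn_fdiv hΩ.isOpen hvΩ)))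
      fun x hx => ?_
    refine (norm_add_le _ _).trans (add_le_add ?_ ?_)
    · exact (abs_real_inner_le_norm _ _).trans (mul_le_mul (hB' x hx) (hMv x (subset_closure hx))
        (norm_nonneg _) ((norm_nonneg _).trans (hB' x hx)))
    · rw [norm_mul]
      exact mul_le_mul (hB x hx) (hMdiv x hx) (abs_nonneg _) ((abs_nonneg _).trans (hB x hx))
  have hsum : ∫ x in Ω, ∑ i, (inner ℝ (k' i x) (v x) + k i x * fdiv v x) = 0 := by
    rw [integral_finsetSum _ fun i _ => hint i]
    exact Finset.sum_eq_zero fun i _ => hpiece i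
  rw [← hsum]
  refine setIntegral_congr_fun hms fun x hx => ?_
  have hk1 : ∀ y ∈ Ω, ∑ i, k i y = h y := fun y hy => by
    simp only [k, ← Finset.sum_mul, hχ1 y (subset_closure hy), one_mul]
  -- The functions `k i` sum to `h` near `x`, so their gradients sum to `h' x` by uniqueness of the
  -- derivative.
  have hk'1 : ∑ i, k' i x = h' x := by
    have h1 : HasFDerivAt (fun y => ∑ i, k i y)
        (∑ i, InnerProductSpace.toDual ℝ (Space D) (k' i x)) x :=
      HasFDerivAt.fun_sum fun i _ => (hk i x hx).hasFDerivAt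
    have h2 : (fun y => ∑ i, k i y) =ᶠ[𝓝 x] h := by
      filter_upwards [hΩ.isOpen.mem_nhds hx] with y hy using hk1 y hy
    have h3 := (h1.congr_of_eventuallyEq h2.symm).unique (hh x hx).hasFDerivAt
    rw [← map_sum] at h3
    exact (InnerProductSpace.toDual ℝ (Space D)).injective h3
  simp only [Finset.sum_add_distrib, ← sum_inner, ← Finset.sum_mul, hk1 x hx, hk'1,
    divergence_eq_fdiv hΩ.isOpen v hx]

/-! ### Iterated directional derivatives -/

section DirectionalDerivatives

variable {E F : Type*} [NormedAddCommGroup E] [NormedSpace ℝ E] [NormedAddCommGroup F]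
  [NormedSpace ℝ F]

theorem contDiffOn_fderiv_apply {U : Set E} (hU : IsOpen U) {f : E → F} {m n : WithTop ℕ∞}
    (hf : ContDiffOn ℝ n f U) (hmn : m + 1 ≤ n) (z : E) :
    ContDiffOn ℝ m (fun y => fderiv ℝ f y z) U :=
  (hf.fderiv_of_isOpen hU hmn).clm_apply contDiffOn_const

theorem fderiv_fderiv_apply {f : E → F} {x : E} (hf : ContDiffAt ℝ 2 f x) (a b : E) :
    fderiv ℝ (fun y => fderiv ℝ f y a) x b = fderiv ℝ (fderiv ℝ f) x b a := by
  have h : DifferentiableAt ℝ (fderiv ℝ f) x :=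
    (hf.fderiv_right (m := 1) (by norm_num)).differentiableAt (by simp)
  rw [fderiv_clm_apply h (differentiableAt_const a)]
  simp

theorem fderiv_fderiv_apply_comm {f : E → F} {x : E} (hf : ContDiffAt ℝ 2 f x) (a b : E) :
    fderiv ℝ (fun y => fderiv ℝ f y a) x b = fderiv ℝ (fun y => fderiv ℝ f y b) x a := by
  rw [fderiv_fderiv_apply hf, fderiv_fderiv_apply hf]
  exact hf.isSymmSndFDerivAt (by simp) b a

/-- The second derivative test at a local maximum. -/
theorem fderiv_fderiv_apply_nonpos_of_isLocalMax {f : E → ℝ} {x : E} (hf : ContDiffAt ℝ 2 f x)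
    (hmax : IsLocalMax f x) (z : E) : fderiv ℝ (fun y => fderiv ℝ f y z) x z ≤ 0 := by
  by_contra! hpos
  let l : ℝ → E := fun s => x + s • z
  have hl : ∀ s, HasDerivAt l z s := fun s =>
    (((hasDerivAt_id s).smul_const z).const_add x).congr_deriv (one_smul ℝ z)
  have hl0 : l 0 = x := by simp [l]
  have hlt : Tendsto l (𝓝 0) (𝓝 x) := hl0 ▸ (hl 0).continuousAt.tendsto
  have hg : ∀ᶠ s in 𝓝 0, HasDerivAt (f ∘ l) (fderiv ℝ f (l s) z) s := by
    have h1 : ∀ᶠ y in 𝓝 x, ContDiffAt ℝ 2 f y := hf.eventually (by simp)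
    filter_upwards [hlt.eventually h1] with s hs
    exact (hs.differentiableAt (by simp)).hasFDerivAt.comp_hasDerivAt s (hl s)
  have hd1 : deriv (f ∘ l) =ᶠ[𝓝 0] fun s => fderiv ℝ f (l s) z := by
    filter_upwards [hg] with s hs using hs.deriv
  have hdd : deriv (deriv (f ∘ l)) 0 = fderiv ℝ (fun y => fderiv ℝ f y z) x z := by
    rw [hd1.deriv_eq]
    have h2 : DifferentiableAt ℝ (fun y => fderiv ℝ f y z) x :=
      ((hf.fderiv_right (m := 1) (by norm_num)).clm_apply contDiffAt_const).differentiableAt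
        (by simp)
    have h3 : HasFDerivAt (fun y => fderiv ℝ f y z) (fderiv ℝ (fun y => fderiv ℝ f y z) x) (l 0) :=
      hl0 ▸ h2.hasFDerivAt
    exact (h3.comp_hasDerivAt 0 (hl 0)).deriv
  have hlmax : IsLocalMax (f ∘ l) 0 := by
    have : ∀ᶠ y in 𝓝 x, f y ≤ f x := hmax
    filter_upwards [hlt.eventually this] with s hs
    simpa [hl0] using hs
  -- A positive second derivative makes the maximum along the line also a minimum; `f ∘ l` is then
  -- locally constant, which forces that second derivative to be zero.
  have hlmin : IsLocalMin (f ∘ l) 0 :=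
    isLocalMin_of_deriv_deriv_pos (hdd ▸ hpos) hlmax.deriv_eq_zero hg.self_of_nhds.continuousAt
  have hconst : (f ∘ l) =ᶠ[𝓝 0] fun _ => (f ∘ l) 0 := by
    filter_upwards [hlmax, hlmin] with s h1 h2 using le_antisymm h1 h2
  have h0 : deriv (deriv (f ∘ l)) 0 = 0 := by
    rw [hconst.deriv.deriv_eq]
    simp
  rw [hdd] at h0
  linarith

end DirectionalDerivatives

/-! ### The Laplacian at interior points -/

/-- The Laplacian of a function defined near the point under consideration. -/
def flap {F : Type*} [NormedAddCommGroup F] [NormedSpace ℝ F] (f : Space D → F) (x : Space D) : F :=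
  ∑ j : Fin D, fderiv ℝ (fun y => fderiv ℝ f y (EuclideanSpace.single j 1)) x
    (EuclideanSpace.single j 1)

section Laplacian

variable {F : Type*} [NormedAddCommGroup F] [NormedSpace ℝ F]

theorem lap_eq_sum (hs : UniqueDiffOn ℝ (closure Ω)) (f : Space D → F) {x : Space D}
    (hx : x ∈ closure Ω) :
    lap Ω f x = ∑ j : Fin D, fderivWithin ℝ (fderivWithin ℝ f (closure Ω)) (closure Ω) x
      (EuclideanSpace.single j 1) (EuclideanSpace.single j 1) := by
  rw [lap, InnerProductSpace.laplacianWithin_eq_iteratedFDerivWithin_orthonormalBasis f hs hx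
    (EuclideanSpace.basisFun (Fin D) ℝ)]
  refine Finset.sum_congr rfl fun j _ => ?_
  rw [iteratedFDerivWithin_two_apply f hs hx]
  simp

theorem continuousOn_lap (hs : UniqueDiffOn ℝ (closure Ω)) {f : Space D → F}
    (hf : ContDiffOn ℝ 2 f (closure Ω)) : ContinuousOn (lap Ω f) (closure Ω) := by
  have h1 : ContDiffOn ℝ 1 (fderivWithin ℝ f (closure Ω)) (closure Ω) :=
    hf.fderivWithin hs (by norm_num)
  have h2 := h1.continuousOn_fderivWithin hs le_rfl
  have h3 : ContinuousOn (fun x => ∑ j : Fin D, fderivWithin ℝ (fderivWithin ℝ f (closure Ω))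
      (closure Ω) x (EuclideanSpace.single j 1) (EuclideanSpace.single j 1)) (closure Ω) :=
    continuousOn_finsetSum _ fun j _ =>
      (h2.clm_apply continuousOn_const).clm_apply continuousOn_const
  exact h3.congr fun x hx => lap_eq_sum hs f hx

theorem fderivWithin_closure_eventuallyEq (hΩ : IsOpen Ω) (f : Space D → F) {x : Space D}
    (hx : x ∈ Ω) : fderivWithin ℝ f (closure Ω) =ᶠ[𝓝 x] fderiv ℝ f := by
  filter_upwards [hΩ.mem_nhds hx] with y hy
  exact fderivWithin_of_mem_nhds (closure_mem_nhds hΩ hy)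

theorem lap_eq_flap (hΩ : IsOpen Ω) (hs : UniqueDiffOn ℝ (closure Ω)) {f : Space D → F}
    {x : Space D} (hf : ContDiffAt ℝ 2 f x) (hx : x ∈ Ω) : lap Ω f x = flap f x := by
  rw [lap_eq_sum hs f (subset_closure hx), flap]
  refine Finset.sum_congr rfl fun j _ => ?_
  rw [fderivWithin_of_mem_nhds (closure_mem_nhds hΩ hx),
    (fderivWithin_closure_eventuallyEq hΩ f hx).fderiv_eq, fderiv_fderiv_apply hf]

theorem contDiffOn_flap (hΩ : IsOpen Ω) {f : Space D → F} (hf : ContDiffOn ℝ 3 f Ω) :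
    ContDiffOn ℝ 1 (flap f) Ω :=
  ContDiffOn.sum fun j _ => contDiffOn_fderiv_apply hΩ
    (contDiffOn_fderiv_apply hΩ hf (m := 2) (by norm_num) _) (by norm_num) _

end Laplacian

theorem fdiv_eq_sum {v : Space D → Space D} (x : Space D) :
    fdiv v x = ∑ i, EuclideanSpace.proj (𝕜 := ℝ) i
      (fderiv ℝ v x (EuclideanSpace.single i 1)) := rfl

/-- The divergence and the Laplacian commute. -/
theorem fdiv_flap (hΩ : IsOpen Ω) {v : Space D → Space D} (hv : ContDiffOn ℝ 3 v Ω)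
    {x : Space D} (hx : x ∈ Ω) : fdiv (flap v) x = flap (fdiv v) x := by
  have h1 : ∀ z, ContDiffOn ℝ 2 (fun y => fderiv ℝ v y z) Ω := fun z =>
    contDiffOn_fderiv_apply hΩ hv (by norm_num) z
  have h2 : ∀ a b, ContDiffOn ℝ 1 (fun y => fderiv ℝ (fun y' => fderiv ℝ v y' a) y b) Ω :=
    fun a b => contDiffOn_fderiv_apply hΩ (h1 a) (by norm_num) b
  have hd1 : ∀ z, ∀ y ∈ Ω, DifferentiableAt ℝ (fun y => fderiv ℝ v y z) y := fun z y hy =>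
    ((h1 z).contDiffAt (hΩ.mem_nhds hy)).differentiableAt (by simp)
  have hd2 : ∀ a b, DifferentiableAt ℝ (fun y => fderiv ℝ (fun y' => fderiv ℝ v y' a) y b) x :=
    fun a b => ((h2 a b).contDiffAt (hΩ.mem_nhds hx)).differentiableAt (by simp)
  -- Third derivatives are reordered by two exchanges: first the two outer derivatives at `x`, then
  -- the two inner ones in a neighbourhood of `x`.
  have hcomm : ∀ a b, fderiv ℝ (fun y => fderiv ℝ (fun y' => fderiv ℝ v y' a) y a) x b =
      fderiv ℝ (fun y => fderiv ℝ (fun y' => fderiv ℝ v y' b) y a) x a := fun a b => by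
    rw [fderiv_fderiv_apply_comm ((h1 a).contDiffAt (hΩ.mem_nhds hx)) a b]
    have : (fun y => fderiv ℝ (fun y' => fderiv ℝ v y' a) y b) =ᶠ[𝓝 x]
        fun y => fderiv ℝ (fun y' => fderiv ℝ v y' b) y a := by
      filter_upwards [hΩ.mem_nhds hx] with y hy
      exact fderiv_fderiv_apply_comm ((hv.contDiffAt (hΩ.mem_nhds hy)).of_le (by norm_num)) a b
    rw [this.fderiv_eq]
  have hL : ∀ i : Fin D, fderiv ℝ (flap v) x (EuclideanSpace.single i 1) = ∑ j : Fin D,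
      fderiv ℝ (fun y => fderiv ℝ (fun y' => fderiv ℝ v y' (EuclideanSpace.single i 1)) y
        (EuclideanSpace.single j 1)) x (EuclideanSpace.single j 1) := fun i => by
    have : fderiv ℝ (flap v) x = ∑ j : Fin D, fderiv ℝ (fun y => fderiv ℝ (fun y' =>
        fderiv ℝ v y' (EuclideanSpace.single j 1)) y (EuclideanSpace.single j 1)) x :=
      fderiv_fun_sum fun j _ => hd2 _ _
    rw [this, sum_apply]
    exact Finset.sum_congr rfl fun j _ => hcomm _ _
  have hR1 : ∀ j : Fin D, ∀ y ∈ Ω, fderiv ℝ (fdiv v) y (EuclideanSpace.single j 1) =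
      ∑ i, EuclideanSpace.proj (𝕜 := ℝ) i (fderiv ℝ (fun y' => fderiv ℝ v y'
        (EuclideanSpace.single i 1)) y (EuclideanSpace.single j 1)) := fun j y hy => by
    have : HasFDerivAt (fdiv v) (∑ i, (EuclideanSpace.proj (𝕜 := ℝ) i).comp
        (fderiv ℝ (fun y' => fderiv ℝ v y' (EuclideanSpace.single i 1)) y)) y :=
      HasFDerivAt.fun_sum fun i _ =>
        (EuclideanSpace.proj (𝕜 := ℝ) i).hasFDerivAt.comp y (hd1 _ y hy).hasFDerivAt
    rw [this.fderiv]
    simp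
  have hR2 : flap (fdiv v) x = ∑ j : Fin D, ∑ i, EuclideanSpace.proj (𝕜 := ℝ) i
      (fderiv ℝ (fun y => fderiv ℝ (fun y' => fderiv ℝ v y' (EuclideanSpace.single i 1)) y
        (EuclideanSpace.single j 1)) x (EuclideanSpace.single j 1)) := by
    refine Finset.sum_congr rfl fun j _ => ?_
    have he : (fun y => fderiv ℝ (fdiv v) y (EuclideanSpace.single j 1)) =ᶠ[𝓝 x] _ :=
      eventually_of_mem (hΩ.mem_nhds hx) (hR1 j)
    have : HasFDerivAt (fun y => ∑ i, EuclideanSpace.proj (𝕜 := ℝ) i (fderiv ℝ (fun y' =>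
        fderiv ℝ v y' (EuclideanSpace.single i 1)) y (EuclideanSpace.single j 1)))
        (∑ i, (EuclideanSpace.proj (𝕜 := ℝ) i).comp (fderiv ℝ (fun y => fderiv ℝ (fun y' =>
          fderiv ℝ v y' (EuclideanSpace.single i 1)) y (EuclideanSpace.single j 1)) x)) x :=
      HasFDerivAt.fun_sum fun i _ =>
        (EuclideanSpace.proj (𝕜 := ℝ) i).hasFDerivAt.comp x (hd2 _ _).hasFDerivAt
    rw [he.fderiv_eq, this.fderiv]
    simp
  rw [hR2, Finset.sum_comm, fdiv_eq_sum]
  refine Finset.sum_congr rfl fun i _ => ?_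
  rw [hL, map_sum]

/-! ### The maximum principle for the heat equation -/

theorem flap_nonpos_of_isLocalMax {f : Space D → ℝ} {x : Space D} (hf : ContDiffAt ℝ 2 f x)
    (hmax : IsLocalMax f x) : flap f x ≤ 0 :=
  Finset.sum_nonpos fun _ _ => fderiv_fderiv_apply_nonpos_of_isLocalMax hf hmax _

/-- Weak maximum principle. If `f` were positive somewhere, `f - ε (t - t₀)` would have a positive
maximum on the compact cylinder, attained at an interior point of space and after `t₀`. There the
Laplacian is nonpositive, while the time derivative is at least `ε`. -/
theorem heat_nonpos (hΩ : IsOpen Ω) (hc : IsCompact (closure Ω)) {ν t₀ T : ℝ} (hν : 0 < ν)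
    {f : ℝ → Space D → ℝ}
    (hf : ContinuousOn (fun p : ℝ × Space D => f p.1 p.2) (Icc t₀ T ×ˢ closure Ω))
    (h0 : ∀ x ∈ closure Ω, f t₀ x ≤ 0) (hb : ∀ t ∈ Icc t₀ T, ∀ x ∈ frontier Ω, f t x ≤ 0)
    (hsm : ∀ t ∈ Icc t₀ T, ∀ x ∈ Ω, ContDiffAt ℝ 2 (f t) x)
    (heat : ∀ t ∈ Icc t₀ T, ∀ x ∈ Ω,
      HasDerivWithinAt (fun s => f s x) (ν * flap (f t) x) (Icc t₀ T) t) :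
    ∀ t ∈ Icc t₀ T, ∀ x ∈ closure Ω, f t x ≤ 0 := by
  intro t ht x hx
  by_contra! hpos
  obtain ⟨ε, hε, hεlt⟩ : ∃ ε > 0, ε * (t - t₀) < f t x := by
    -- The added `1` keeps the denominator positive when `t = t₀`.
    refine ⟨f t x / (2 * (t - t₀ + 1)), by have := ht.1; positivity, ?_⟩
    have h1 : 0 ≤ t - t₀ := by linarith [ht.1]
    rw [div_mul_eq_mul_div, div_lt_iff₀ (by positivity)]
    nlinarith
  let m : ℝ × Space D → ℝ := fun p => f p.1 p.2 - ε * (p.1 - t₀)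
  have hm : ContinuousOn m (Icc t₀ T ×ˢ closure Ω) := hf.sub (by fun_prop)
  obtain ⟨⟨a, y⟩, ⟨ha, hy⟩, hmax⟩ := (isCompact_Icc.prod hc).exists_isMaxOn ⟨(t, x), ht, hx⟩ hm
  simp only at ha hy
  have hle : ∀ s ∈ Icc t₀ T, ∀ z ∈ closure Ω, f s z - ε * (s - t₀) ≤ f a y - ε * (a - t₀) :=
    fun s hs z hz => hmax (show (s, z) ∈ Icc t₀ T ×ˢ closure Ω from ⟨hs, hz⟩)
  have hmpos : 0 < f a y - ε * (a - t₀) := by linarith [hle t ht x hx]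
  have hfpos : 0 < f a y := by nlinarith [ha.1]
  have hat : t₀ < a := lt_of_le_of_ne ha.1 fun h => by
    rw [← h] at hfpos; linarith [h0 y hy]
  have hyΩ : y ∈ Ω := by
    by_contra hn
    have : y ∈ frontier Ω := by rw [hΩ.frontier_eq]; exact ⟨hy, hn⟩
    linarith [hb a ha y this]
  have hlap : flap (f a) y ≤ 0 := by
    refine flap_nonpos_of_isLocalMax (hsm a ha y hyΩ) ?_
    filter_upwards [hΩ.mem_nhds hyΩ] with z hz
    linarith [hle a ha z (subset_closure hz)]
  -- Only difference quotients from the past are used, since the maximum may sit at the final time.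
  have hder := (heat a ha y hyΩ).mono (Ico_subset_Icc_self.trans (Icc_subset_Icc_right ha.2))
  have htend := (hasDerivWithinAt_iff_tendsto_slope' right_notMem_Ico).1 hder
  rw [nhdsWithin_Ico_eq_nhdsLT hat] at htend
  have hge : ε ≤ ν * flap (f a) y := by
    refine ge_of_tendsto htend ?_
    filter_upwards [Ico_mem_nhdsLT hat] with s hs
    rw [slope_def_field, le_div_iff_of_neg (by linarith [hs.2])]
    linarith [hle s ⟨hs.1, hs.2.le.trans ha.2⟩ y hy]
  nlinarith [mul_nonneg hν.le (neg_nonneg.2 hlap)]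

/-! ### Functions of time and space -/

section TimeSpace

variable {E F : Type*} [NormedAddCommGroup E] [NormedSpace ℝ E] [NormedAddCommGroup F]
  [NormedSpace ℝ F] {J : Set ℝ} {K : Set E}

/-- The time derivative of `f` at `(t, x)`, within `J × K`. -/
def timeDeriv (J : Set ℝ) (K : Set E) (f : ℝ → E → F) (t : ℝ) (x : E) : F :=
  fderivWithin ℝ (fun p : ℝ × E => f p.1 p.2) (J ×ˢ K) (t, x) (1, 0)

theorem hasDerivWithinAt_timeDeriv {f : ℝ → E → F}
    (hf : DifferentiableOn ℝ (fun p : ℝ × E => f p.1 p.2) (J ×ˢ K)) {t : ℝ} (ht : t ∈ J) {x : E}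
    (hx : x ∈ K) : HasDerivWithinAt (fun s => f s x) (timeDeriv J K f t x) J t := by
  have h1 := (hf (t, x) ⟨ht, hx⟩).hasFDerivWithinAt
  have h2 : HasDerivWithinAt (fun s : ℝ => (s, x)) ((1 : ℝ), (0 : E)) J t :=
    (hasDerivWithinAt_id t J).prodMk (hasDerivWithinAt_const t J x)
  have hm : MapsTo (fun s : ℝ => (s, x)) J (J ×ˢ K) := fun s hs => ⟨hs, hx⟩
  exact h1.comp_hasDerivWithinAt t h2 hm

theorem hasFDerivWithinAt_slice {f : ℝ → E → F}
    (hf : DifferentiableOn ℝ (fun p : ℝ × E => f p.1 p.2) (J ×ˢ K)) {t : ℝ} (ht : t ∈ J) {x : E}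
    (hx : x ∈ K) : HasFDerivWithinAt (f t)
      ((fderivWithin ℝ (fun p : ℝ × E => f p.1 p.2) (J ×ˢ K) (t, x)).comp
        (ContinuousLinearMap.inr ℝ ℝ E)) K x := by
  have h1 := (hf (t, x) ⟨ht, hx⟩).hasFDerivWithinAt
  have h2 : HasFDerivWithinAt (fun y : E => (t, y)) (ContinuousLinearMap.inr ℝ ℝ E) K x :=
    (hasFDerivAt_prodMk_right t x).hasFDerivWithinAt
  exact h1.comp x h2 fun y hy => ⟨ht, hy⟩

theorem contDiffOn_slice {f : ℝ → E → F} {n : WithTop ℕ∞}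
    (hf : ContDiffOn ℝ n (fun p : ℝ × E => f p.1 p.2) (J ×ˢ K)) {t : ℝ} (ht : t ∈ J) :
    ContDiffOn ℝ n (f t) K :=
  hf.comp (contDiffOn_const.prodMk contDiffOn_id) fun _ hy => ⟨ht, hy⟩

theorem fderivWithin_slice (hK : UniqueDiffOn ℝ K) {f : ℝ → E → F}
    (hf : DifferentiableOn ℝ (fun p : ℝ × E => f p.1 p.2) (J ×ˢ K)) {t : ℝ} (ht : t ∈ J) {x : E}
    (hx : x ∈ K) (z : E) : fderivWithin ℝ (f t) K x z =
      fderivWithin ℝ (fun p : ℝ × E => f p.1 p.2) (J ×ˢ K) (t, x) (0, z) := by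
  rw [(hasFDerivWithinAt_slice hf ht hx).fderivWithin (hK x hx)]
  simp

theorem contDiffOn_timeDeriv (hJ : UniqueDiffOn ℝ J) (hK : UniqueDiffOn ℝ K) {f : ℝ → E → F}
    (hf : ContDiffOn ℝ 2 (fun p : ℝ × E => f p.1 p.2) (J ×ˢ K)) :
    ContDiffOn ℝ 1 (fun p : ℝ × E => timeDeriv J K f p.1 p.2) (J ×ˢ K) :=
  (hf.fderivWithin (hJ.prod hK) (by norm_num)).clm_apply contDiffOn_const

/-- Time and space derivatives commute. -/
theorem hasDerivWithinAt_fderivWithin_slice (hJ : UniqueDiffOn ℝ J) (hK : UniqueDiffOn ℝ K)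
    (hJi : J ⊆ closure (interior J)) (hKi : K ⊆ closure (interior K)) {f : ℝ → E → F}
    (hf : ContDiffOn ℝ 2 (fun p : ℝ × E => f p.1 p.2) (J ×ˢ K)) {t : ℝ} (ht : t ∈ J) {x : E}
    (hx : x ∈ K) (z : E) :
    HasDerivWithinAt (fun s => fderivWithin ℝ (f s) K x z)
      (fderivWithin ℝ (timeDeriv J K f t) K x z) J t := by
  have hfd : DifferentiableOn ℝ (fun p : ℝ × E => f p.1 p.2) (J ×ˢ K) :=
    hf.differentiableOn (by simp)
  have hU := hJ.prod hK
  set F' := fderivWithin ℝ (fun p : ℝ × E => f p.1 p.2) (J ×ˢ K) with hF'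
  have hF'c : ContDiffOn ℝ 1 F' (J ×ˢ K) := hf.fderivWithin hU (by norm_num)
  have hF'd : DifferentiableOn ℝ F' (J ×ˢ K) := hF'c.differentiableOn (by simp)
  have hmem : (t, x) ∈ J ×ˢ K := ⟨ht, hx⟩
  -- Symmetry of the second derivative within `J ×ˢ K` extends to boundary points because they are
  -- limits of interior points.
  have hsymm : IsSymmSndFDerivWithinAt ℝ (fun p : ℝ × E => f p.1 p.2) (J ×ˢ K) (t, x) := by
    refine (hf _ hmem).isSymmSndFDerivWithinAt (by simp) hU ?_ hmem
    rw [interior_prod_eq, closure_prod_eq]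
    exact ⟨hJi ht, hKi hx⟩
  have h1 : ∀ c : ℝ × E, HasFDerivWithinAt (fun p => F' p c)
      ((fderivWithin ℝ F' (J ×ˢ K) (t, x)).flip c) (J ×ˢ K) (t, x) := fun c => by
    have := (hF'd _ hmem).hasFDerivWithinAt.clm_apply (hasFDerivWithinAt_const c (t, x) (J ×ˢ K))
    simpa using this
  have h2 : HasDerivWithinAt (fun s : ℝ => (s, x)) ((1 : ℝ), (0 : E)) J t :=
    (hasDerivWithinAt_id t J).prodMk (hasDerivWithinAt_const t J x)
  have h3 : HasFDerivWithinAt (fun y : E => (t, y)) (ContinuousLinearMap.inr ℝ ℝ E) K x :=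
    (hasFDerivAt_prodMk_right t x).hasFDerivWithinAt
  have hm : MapsTo (fun s : ℝ => (s, x)) J (J ×ˢ K) := fun s hs => ⟨hs, hx⟩
  have hA := (h1 (0, z)).comp_hasDerivWithinAt t h2 hm
  have hB : HasFDerivWithinAt (timeDeriv J K f t) _ K x :=
    (h1 (1, 0)).comp x h3 fun y hy => ⟨ht, hy⟩
  have heq : fderivWithin ℝ (timeDeriv J K f t) K x z =
      (fderivWithin ℝ F' (J ×ˢ K) (t, x)).flip (0, z) (1, 0) := by
    rw [hB.fderivWithin (hK x hx)]
    simpa using hsymm (0, z) (1, 0)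
  rw [heq]
  exact hA.congr (fun s hs => fderivWithin_slice hK hfd hs hx z)
    (fderivWithin_slice hK hfd ht hx z)

theorem continuousOn_fderivWithin_slice (hJ : UniqueDiffOn ℝ J) (hK : UniqueDiffOn ℝ K)
    {f : ℝ → E → F} (hf : ContDiffOn ℝ 2 (fun p : ℝ × E => f p.1 p.2) (J ×ˢ K)) (z : E) :
    ContinuousOn (fun p : ℝ × E => fderivWithin ℝ (f p.1) K p.2 z) (J ×ˢ K) := by
  have h := (hf.continuousOn_fderivWithin (hJ.prod hK) (by norm_num)).clm_apply
    (continuousOn_const (c := ((0 : ℝ), z)))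
  exact h.congr fun p hp => fderivWithin_slice hK (hf.differentiableOn (by simp)) hp.1 hp.2 z

end TimeSpace

theorem subset_closure_interior_closure (hΩ : IsOpen Ω) :
    closure Ω ⊆ closure (interior (closure Ω)) :=
  closure_mono (interior_maximal subset_closure hΩ)

theorem uniqueDiffOn_of_ordConnected {J : Set ℝ} (hJ : J.OrdConnected) (hn : J.Nontrivial) :
    UniqueDiffOn ℝ J ∧ J ⊆ closure (interior J) := by
  obtain ⟨a, ha, b, hb, hab⟩ := hn.exists_lt
  have hi : (interior J).Nonempty := by
    refine (nonempty_Ioo.2 hab).mono (interior_maximal ?_ isOpen_Ioo)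
    exact Ioo_subset_Icc_self.trans (hJ.out ha hb)
  have hconv : Convex ℝ J := hJ.convex
  refine ⟨uniqueDiffOn_convex hconv hi, ?_⟩
  rw [hconv.closure_interior_eq_closure_of_nonempty_interior hi]
  exact subset_closure

/-- Within an interval with least element, every point has a compact interval neighbourhood. -/
theorem exists_Icc_mem_nhdsWithin {J : Set ℝ} (hJ : J.OrdConnected) {t₀ : ℝ} (ht₀ : IsLeast J t₀)
    {t : ℝ} (ht : t ∈ J) : ∃ b ∈ J, t ≤ b ∧ Icc t₀ b ⊆ J ∧ Icc t₀ b ∈ 𝓝[J] t := by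
  by_cases hmax : ∃ b ∈ J, t < b
  · obtain ⟨b, hb, htb⟩ := hmax
    refine ⟨b, hb, htb.le, hJ.out ht₀.1 hb, ?_⟩
    filter_upwards [self_mem_nhdsWithin, nhdsWithin_le_nhds (Iio_mem_nhds htb)] with s hs hsb
    exact ⟨ht₀.2 hs, le_of_lt hsb⟩
  · push Not at hmax
    refine ⟨t, ht, le_rfl, hJ.out ht₀.1 ht, ?_⟩
    filter_upwards [self_mem_nhdsWithin] with s hs
    exact ⟨ht₀.2 hs, hmax s hs⟩

/-- Differentiation under the integral sign for functions that are `C¹` up to the boundary. -/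
theorem hasDerivWithinAt_setIntegral (hΩ : IsLipschitzDomain Ω) {J : Set ℝ}
    (hJ : J.OrdConnected) {t₀ : ℝ} (ht₀ : IsLeast J t₀) {f f' : ℝ → Space D → ℝ}
    (hf : ContinuousOn (fun p : ℝ × Space D => f p.1 p.2) (J ×ˢ closure Ω))
    (hf' : ContinuousOn (fun p : ℝ × Space D => f' p.1 p.2) (J ×ˢ closure Ω))
    (hd : ∀ t ∈ J, ∀ x ∈ Ω, HasDerivWithinAt (fun s => f s x) (f' t x) J t) {t : ℝ} (ht : t ∈ J) :
    HasDerivWithinAt (fun s => ∫ x in Ω, f s x) (∫ x in Ω, f' t x) J t := by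
  have hfin := hΩ.isFiniteMeasure_restrict
  have hms := hΩ.isOpen.measurableSet
  -- Restricting to a compact time interval makes `f'` bounded; the mean value inequality then turns
  -- this bound into a dominating constant for the difference quotients.
  obtain ⟨b, hb, htb, hsub, hnhds⟩ := exists_Icc_mem_nhdsWithin hJ ht₀ ht
  refine HasDerivWithinAt.mono_of_mem_nhdsWithin ?_ hnhds
  obtain ⟨M, hM⟩ := (isCompact_Icc.prod hΩ.isCompact_closure).exists_bound_of_continuousOn
    (hf'.mono (prod_mono hsub Subset.rfl))
  have hslice : ∀ s ∈ J, ContinuousOn (f s) (closure Ω) := fun s hs =>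
    hf.comp (by fun_prop : Continuous fun x : Space D => (s, x)).continuousOn
      fun x hx => ⟨hs, hx⟩
  have hint : ∀ s ∈ J, IntegrableOn (f s) Ω := fun s hs =>
    hΩ.integrableOn_of_continuousOn_closure (hslice s hs)
  have htI : t ∈ Icc t₀ b := ⟨ht₀.2 ht, htb⟩
  rw [hasDerivWithinAt_iff_tendsto_slope]
  have heq : ∀ᶠ s in 𝓝[Icc t₀ b \ {t}] t, ∫ x in Ω, slope (fun s => f s x) t s =
      slope (fun s => ∫ x in Ω, f s x) t s := by
    filter_upwards [self_mem_nhdsWithin] with s hs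
    simp only [slope_def_module]
    rw [integral_smul, integral_sub (hint s (hsub hs.1)) (hint t ht)]
  refine Tendsto.congr' heq ?_
  refine tendsto_integral_filter_of_dominated_convergence (fun _ => M) ?_ ?_
    (integrable_const _) ?_
  · filter_upwards [self_mem_nhdsWithin] with s hs
    simp only [slope_def_module]
    exact (((hint s (hsub hs.1)).sub (hint t ht)).smul (s - t)⁻¹).aestronglyMeasurable
  · filter_upwards [self_mem_nhdsWithin] with s hs
    filter_upwards [ae_restrict_mem hms] with x hx
    have h := Convex.norm_image_sub_le_of_norm_hasDerivWithin_le (f := fun s => f s x)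
      (f' := fun s => f' s x) (s := Icc t₀ b) (C := M)
      (fun s hs => (hd s (hsub hs) x hx).mono hsub)
      (fun s hs => hM (s, x) ⟨hs, subset_closure hx⟩) (convex_Icc _ _) htI hs.1
    have hne : 0 < ‖s - t‖ := norm_pos_iff.2 (sub_ne_zero.2 hs.2)
    rw [slope_def_module, norm_smul, norm_inv, inv_mul_le_iff₀ hne]
    linarith
  · filter_upwards [ae_restrict_mem hms] with x hx
    exact hasDerivWithinAt_iff_tendsto_slope.1 ((hd t ht x hx).mono hsub)

/-! ### Linearity of the divergence, and the divergence of a gradient -/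

theorem fdiv_add {v v' : Space D → Space D} {x : Space D} (h : DifferentiableAt ℝ v x)
    (h' : DifferentiableAt ℝ v' x) : fdiv (fun y => v y + v' y) x = fdiv v x + fdiv v' x := by
  simp [fdiv, fderiv_fun_add h h', Finset.sum_add_distrib]

theorem fdiv_sub {v v' : Space D → Space D} {x : Space D} (h : DifferentiableAt ℝ v x)
    (h' : DifferentiableAt ℝ v' x) : fdiv (fun y => v y - v' y) x = fdiv v x - fdiv v' x := by
  simp [fdiv, fderiv_fun_sub h h', Finset.sum_sub_distrib]

theorem fdiv_const_smul {v : Space D → Space D} {x : Space D} (h : DifferentiableAt ℝ v x)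
    (c : ℝ) : fdiv (fun y => c • v y) x = c * fdiv v x := by
  simp [fdiv, fderiv_fun_const_smul h, Finset.mul_sum]

theorem contDiffOn_grad {f : Space D → ℝ} {m n : WithTop ℕ∞} (hs : UniqueDiffOn ℝ (closure Ω))
    (hf : ContDiffOn ℝ n f (closure Ω)) (hmn : m + 1 ≤ n) :
    ContDiffOn ℝ m (grad Ω f) (closure Ω) :=
  (InnerProductSpace.toDual ℝ (Space D)).symm.contDiff.comp_contDiffOn
    (hf.fderivWithin hs hmn)

/-- The pressure `q` is `C²` only inside `Ω`, so its second derivatives need this interior version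
of `contDiffOn_grad`. -/
theorem contDiffOn_grad_of_isOpen {f : Space D → ℝ} {m n : WithTop ℕ∞} (hΩ : IsOpen Ω)
    (hf : ContDiffOn ℝ n f Ω) (hmn : m + 1 ≤ n) : ContDiffOn ℝ m (grad Ω f) Ω := by
  have h1 : ContDiffOn ℝ m (fderivWithin ℝ f (closure Ω)) Ω :=
    (hf.fderiv_of_isOpen hΩ hmn).congr fun x hx =>
      fderivWithin_of_mem_nhds (closure_mem_nhds hΩ hx)
  exact (InnerProductSpace.toDual ℝ (Space D)).symm.contDiff.comp_contDiffOn h1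

theorem inner_grad (f : Space D → ℝ) (x z : Space D) :
    inner ℝ (grad Ω f x) z = fderivWithin ℝ f (closure Ω) x z := by
  simp [grad, gradientWithin]

theorem hasGradientAt_grad (hΩ : IsOpen Ω) {f : Space D → ℝ} {x : Space D} (hx : x ∈ Ω)
    (hf : DifferentiableAt ℝ f x) : HasGradientAt f (grad Ω f x) x := by
  rw [hasGradientAt_iff_hasFDerivAt, grad, gradientWithin, LinearIsometryEquiv.apply_symm_apply,
    fderivWithin_of_mem_nhds (closure_mem_nhds hΩ hx)]
  exact hf.hasFDerivAt

theorem fdiv_grad (hΩ : IsOpen Ω) {f : Space D → ℝ} (hf : ContDiffOn ℝ 2 f Ω) {x : Space D}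
    (hx : x ∈ Ω) : fdiv (grad Ω f) x = flap f x := by
  have hd : DifferentiableAt ℝ (grad Ω f) x :=
    ((contDiffOn_grad_of_isOpen hΩ hf (m := 1) (by norm_num)).contDiffAt
      (hΩ.mem_nhds hx)).differentiableAt (by simp)
  rw [fdiv_eq_sum, flap]
  refine Finset.sum_congr rfl fun j _ => ?_
  have h1 : HasFDerivAt (fun y => EuclideanSpace.proj (𝕜 := ℝ) j (grad Ω f y)) _ x :=
    (EuclideanSpace.proj (𝕜 := ℝ) j).hasFDerivAt.comp x hd.hasFDerivAt
  have h2 : (fun y => fderiv ℝ f y (EuclideanSpace.single j 1)) =ᶠ[𝓝 x]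
      fun y => EuclideanSpace.proj (𝕜 := ℝ) j (grad Ω f y) := by
    filter_upwards [hΩ.mem_nhds hx] with y hy
    rw [← fderivWithin_of_mem_nhds (closure_mem_nhds hΩ hy), ← inner_grad,
      EuclideanSpace.inner_single_right]
    simp
  rw [h2.fderiv_eq, h1.fderiv]
  rfl

theorem flap_neg {f : Space D → ℝ} (x : Space D) : flap (fun y => -f y) x = -flap f x := by
  simp only [flap, fderiv_fun_neg, neg_apply, Finset.sum_neg_distrib]

theorem flap_congr {F : Type*} [NormedAddCommGroup F] [NormedSpace ℝ F] {f f' : Space D → F}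
    {x : Space D} (h : f =ᶠ[𝓝 x] f') : flap f x = flap f' x := by
  refine Finset.sum_congr rfl fun j _ => ?_
  have : (fun y => fderiv ℝ f y (EuclideanSpace.single j 1)) =ᶠ[𝓝 x]
      fun y => fderiv ℝ f' y (EuclideanSpace.single j 1) := by
    filter_upwards [h.fderiv (𝕜 := ℝ)] with y hy
    rw [hy]
  rw [this.fderiv_eq]

theorem contDiffOn_fdiv (hΩ : IsOpen Ω) {v : Space D → Space D} {m n : WithTop ℕ∞}
    (hv : ContDiffOn ℝ n v Ω) (hmn : m + 1 ≤ n) : ContDiffOn ℝ m (fdiv v) Ω :=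
  ContDiffOn.sum fun i _ => (EuclideanSpace.proj (𝕜 := ℝ) i).contDiff.comp_contDiffOn
    (contDiffOn_fderiv_apply hΩ hv hmn _)

theorem contDiffOn_convection {u : Space D → Space D} (hs : UniqueDiffOn ℝ (closure Ω))
    (hu : ContDiffOn ℝ 2 u (closure Ω)) : ContDiffOn ℝ 1 (convection Ω u) (closure Ω) :=
  (hu.fderivWithin hs (by norm_num)).clm_apply (hu.of_le (by norm_num))

theorem heat_eq_zero (hΩ : IsOpen Ω) (hc : IsCompact (closure Ω)) {ν t₀ T : ℝ} (hν : 0 < ν)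
    {f : ℝ → Space D → ℝ}
    (hf : ContinuousOn (fun p : ℝ × Space D => f p.1 p.2) (Icc t₀ T ×ˢ closure Ω))
    (h0 : ∀ x ∈ closure Ω, f t₀ x = 0) (hb : ∀ t ∈ Icc t₀ T, ∀ x ∈ frontier Ω, f t x = 0)
    (hsm : ∀ t ∈ Icc t₀ T, ∀ x ∈ Ω, ContDiffAt ℝ 2 (f t) x)
    (heat : ∀ t ∈ Icc t₀ T, ∀ x ∈ Ω,
      HasDerivWithinAt (fun s => f s x) (ν * flap (f t) x) (Icc t₀ T) t) :
    ∀ t ∈ Icc t₀ T, ∀ x ∈ closure Ω, f t x = 0 := by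
  intro t ht x hx
  refine le_antisymm (heat_nonpos hΩ hc hν hf (fun x hx => (h0 x hx).le)
    (fun t ht x hx => (hb t ht x hx).le) hsm heat t ht x hx) ?_
  have := heat_nonpos hΩ hc hν (f := fun t x => -f t x) hf.neg
    (fun x hx => by simp [h0 x hx]) (fun t ht x hx => by simp [hb t ht x hx])
    (fun t ht x hx => (hsm t ht x hx).neg)
    (fun t ht x hx => by
      rw [flap_neg, mul_neg]
      exact (heat t ht x hx).neg) t ht x hx
  linarith

/-- The divergence of the right-hand side of the momentum equation. -/
theorem fdiv_momentum (hΩ : IsLipschitzDomain Ω) {g u w : Space D → Space D} {q : Space D → ℝ}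
    {r ν : ℝ} (hg : ContDiffOn ℝ 1 g Ω) (hu : ContDiffOn ℝ 2 u (closure Ω))
    (hw : ContDiffOn ℝ 3 w Ω) (hq : ContDiffOn ℝ 2 q Ω) {x : Space D} (hx : x ∈ Ω)
    (hp : lap Ω q x = divergence Ω (fun y => g y - r • convection Ω u y) x) :
    fdiv (fun y => g y - r • convection Ω u y - grad Ω q y + ν • lap Ω w y) x =
      ν * flap (fdiv w) x := by
  have ho := hΩ.isOpen
  have hs := hΩ.uniqueDiffOn_closure
  have hdiff : ∀ {v : Space D → Space D}, ContDiffOn ℝ 1 v Ω → DifferentiableAt ℝ v x :=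
    fun hv => (hv.contDiffAt (ho.mem_nhds hx)).differentiableAt (by simp)
  have h1 : DifferentiableAt ℝ (fun y => g y - r • convection Ω u y) x :=
    (hdiff hg).sub ((hdiff ((contDiffOn_convection hs hu).mono subset_closure)).const_smul r)
  have h2 : DifferentiableAt ℝ (grad Ω q) x :=
    hdiff (contDiffOn_grad_of_isOpen ho hq (by norm_num))
  have h3 : lap Ω w =ᶠ[𝓝 x] flap w := by
    filter_upwards [ho.mem_nhds hx] with y hy
    exact lap_eq_flap ho hs ((hw.contDiffAt (ho.mem_nhds hy)).of_le (by norm_num)) hy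
  have h4 : DifferentiableAt ℝ (lap Ω w) x :=
    (hdiff (contDiffOn_flap ho hw)).congr_of_eventuallyEq h3
  -- The pressure equation cancels the divergence of `g - r u·∇u` against `Δq`; only the viscous
  -- term survives.
  rw [fdiv_add (v := fun y => g y - r • convection Ω u y - grad Ω q y)
      (v' := fun y => ν • lap Ω w y) (h1.sub h2) (h4.const_smul ν), fdiv_sub h1 h2, fdiv_const_smul h4, fdiv_congr h3,
    fdiv_flap ho hw hx, fdiv_grad ho hq hx, ← divergence_eq_fdiv ho _ hx, ← hp,
    lap_eq_flap ho hs (hq.contDiffAt (ho.mem_nhds hx)) hx]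
  ring

/-! ### Orthogonality relations in `L²` -/

/-- The divergence theorem asks for a bounded scalar factor, and a potential is known only through
its gradient. The truncation `c arctan (p / c)` is bounded, its gradient is no larger than that of
`p`, and the factor multiplying that gradient tends to one as `c → ∞`. -/
theorem hasGradientAt_arctan {p : Space D → ℝ} {G x : Space D} (hp : HasGradientAt p G x)
    {c : ℝ} (hc : c ≠ 0) : HasGradientAt (fun y => c * Real.arctan (p y / c))
      ((1 + (p x / c) ^ 2)⁻¹ • G) x := by
  rw [hasGradientAt_iff_hasFDerivAt]
  have h1 : HasFDerivAt (fun y => p y / c) (c⁻¹ • InnerProductSpace.toDual ℝ (Space D) G) x := by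
    simpa [div_eq_mul_inv] using hp.hasFDerivAt.mul_const c⁻¹
  have h2 := (h1.arctan).const_mul c
  refine h2.congr_fderiv ?_
  rw [map_smul, smul_smul, smul_smul]
  congr 1
  field_simp

theorem abs_arctan_le (c t : ℝ) : |c * Real.arctan t| ≤ |c| * (Real.pi / 2) := by
  rw [abs_mul]
  gcongr
  exact abs_le.2 ⟨(Real.neg_pi_div_two_lt_arctan t).le, (Real.arctan_lt_pi_div_two t).le⟩

theorem inv_one_add_sq_le_one (t : ℝ) : (1 + t ^ 2)⁻¹ ≤ 1 :=
  inv_le_one_of_one_le₀ (by nlinarith [sq_nonneg t])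

/-- A solenoidal field tangent to the boundary annihilates truncations of a potential. -/
theorem integral_arctan_eq_zero (hΩ : IsLipschitzDomain Ω) {v : Space D → Space D}
    (hv : ContDiffOn ℝ 1 v (closure Ω)) (hdiv : ∀ x ∈ Ω, divergence Ω v x = 0)
    (hn : ∀ x n, IsOutwardUnitNormal Ω x n → inner ℝ (v x) n = 0)
    {p : Space D → ℝ} {G : Space D → Space D} (hp : ∀ x ∈ Ω, HasGradientAt p (G x) x)
    (hG : ContinuousOn G (closure Ω)) {c : ℝ} (hc : c ≠ 0) :
    ∫ x in Ω, (1 + (p x / c) ^ 2)⁻¹ * inner ℝ (G x) (v x) = 0 := by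
  obtain ⟨M, hM⟩ := hΩ.isCompact_closure.exists_bound_of_continuousOn hG
  have hpc : ContinuousOn p Ω := fun x hx => (hp x hx).hasFDerivAt.continuousAt.continuousWithinAt
  have hfac : ContinuousOn (fun x => (1 + (p x / c) ^ 2)⁻¹) Ω :=
    ContinuousOn.inv₀ (by fun_prop) fun x _ => by positivity
  have hM' : ∀ x ∈ Ω, ‖(1 + (p x / c) ^ 2)⁻¹ • G x‖ ≤ M := fun x hx => by
    rw [norm_smul, Real.norm_of_nonneg (by positivity)]
    exact (mul_le_of_le_one_left (norm_nonneg _) (inv_one_add_sq_le_one _)).trans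
      (hM x (subset_closure hx))
  have h := integral_flux_eq_zero hΩ hv hn (fun x hx => hasGradientAt_arctan (hp x hx) hc)
    (hfac.smul (hG.mono subset_closure)) (C := max (|c| * (Real.pi / 2)) M)
    (fun x _ => (abs_arctan_le _ _).trans (le_max_left _ _))
    (fun x hx => (hM' x hx).trans (le_max_right _ _))
  rw [← h]
  refine setIntegral_congr_fun hΩ.isOpen.measurableSet fun x hx => ?_
  simp only [hdiv x hx, mul_zero, add_zero, inner_smul_left, conj_trivial]

/-- A solenoidal field tangent to the boundary is orthogonal to gradients. -/
theorem integral_inner_gradient_eq_zero (hΩ : IsLipschitzDomain Ω) {v : Space D → Space D}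
    (hv : ContDiffOn ℝ 1 v (closure Ω)) (hdiv : ∀ x ∈ Ω, divergence Ω v x = 0)
    (hn : ∀ x n, IsOutwardUnitNormal Ω x n → inner ℝ (v x) n = 0)
    {p : Space D → ℝ} {G : Space D → Space D} (hp : ∀ x ∈ Ω, HasGradientAt p (G x) x)
    (hG : ContinuousOn G (closure Ω)) : ∫ x in Ω, inner ℝ (G x) (v x) = 0 := by
  have hms := hΩ.isOpen.measurableSet
  have hpc : ContinuousOn p Ω := fun x hx => (hp x hx).hasFDerivAt.continuousAt.continuousWithinAt
  have hin : ContinuousOn (fun x => inner ℝ (G x) (v x)) (closure Ω) := hG.inner hv.continuousOn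
  -- Remove the truncation by letting `c = n + 1` tend to infinity; the factors are at most one, so
  -- the untruncated integrand dominates.
  have hlim : Tendsto (fun n : ℕ => ∫ x in Ω,
      (1 + (p x / ((n : ℝ) + 1)) ^ 2)⁻¹ * inner ℝ (G x) (v x)) atTop
      (𝓝 (∫ x in Ω, inner ℝ (G x) (v x))) := by
    refine tendsto_integral_of_dominated_convergence (fun x => ‖inner ℝ (G x) (v x)‖)
      (fun n => ?_) (hΩ.integrableOn_of_continuousOn_closure hin).norm (fun n => ?_) ?_
    · have hfac : ContinuousOn (fun x => (1 + (p x / ((n : ℝ) + 1)) ^ 2)⁻¹) Ω :=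
        ContinuousOn.inv₀ (by fun_prop) fun x _ => by positivity
      exact (hfac.mul (hin.mono subset_closure)).aestronglyMeasurable hms
    · refine ae_of_all _ fun x => ?_
      rw [norm_mul, Real.norm_of_nonneg (by positivity)]
      exact mul_le_of_le_one_left (norm_nonneg _) (inv_one_add_sq_le_one _)
    · refine ae_of_all _ fun x => ?_
      have h1 : Tendsto (fun n : ℕ => p x / ((n : ℝ) + 1)) atTop (𝓝 0) := by
        simpa [div_eq_mul_inv] using
          (tendsto_one_div_add_atTop_nhds_zero_nat (𝕜 := ℝ)).const_mul (p x)
      have h2 : Tendsto (fun n : ℕ => (1 + (p x / ((n : ℝ) + 1)) ^ 2)⁻¹) atTop (𝓝 1) := by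
        have := ((h1.pow 2).const_add 1).inv₀ (by norm_num)
        simpa using this
      simpa using h2.mul_const (inner ℝ (G x) (v x))
  simp only [integral_arctan_eq_zero hΩ hv hdiv hn hp hG
    (Nat.cast_add_one_ne_zero (R := ℝ) _)] at hlim
  exact tendsto_nhds_unique hlim tendsto_const_nhds

/-- A solenoidal gradient field tangent to the boundary vanishes. -/
theorem eq_zero_of_solenoidal_gradient (hΩ : IsLipschitzDomain Ω) {v : Space D → Space D}
    (hv : ContDiffOn ℝ 1 v (closure Ω)) (hdiv : ∀ x ∈ Ω, divergence Ω v x = 0)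
    (hn : ∀ x n, IsOutwardUnitNormal Ω x n → inner ℝ (v x) n = 0)
    {p : Space D → ℝ} (hp : ∀ x ∈ Ω, HasGradientAt p (v x) x) :
    ∀ x ∈ closure Ω, v x = 0 := by
  have hms := hΩ.isOpen.measurableSet
  have h0 := integral_inner_gradient_eq_zero hΩ hv hdiv hn hp hv.continuousOn
  have hin : ContinuousOn (fun x => inner ℝ (v x) (v x)) (closure Ω) :=
    hv.continuousOn.inner hv.continuousOn
  have hae := (setIntegral_eq_zero_iff_of_nonneg_ae (ae_of_all _ fun x => real_inner_self_nonneg)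
    (hΩ.integrableOn_of_continuousOn_closure hin)).1 h0
  have hEq : EqOn (fun x => inner ℝ (v x) (v x)) 0 Ω :=
    Measure.eqOn_open_of_ae_eq hae hΩ.isOpen (hin.mono subset_closure) continuousOn_const
  have hcl := hEq.of_subset_closure hin continuousOn_const subset_closure Subset.rfl
  exact fun x hx => inner_self_eq_zero.1 (hcl hx)

/-- The Dirichlet integral of a field vanishing on the boundary. -/
theorem integral_inner_lap (hΩ : IsLipschitzDomain Ω) {u : Space D → Space D}
    (hu : ContDiffOn ℝ 2 u (closure Ω)) (h0 : ∀ x n, IsOutwardUnitNormal Ω x n → u x = 0) :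
    ∫ x in Ω, inner ℝ (u x) (lap Ω u x) = -gradNormSq Ω u := by
  have ho := hΩ.isOpen
  have hms := ho.measurableSet
  have hs := hΩ.uniqueDiffOn_closure
  -- With `s = |u|²/2`, the gradient of `s` vanishes wherever `u` does, so its flux is zero, and `Δs
  -- = u·Δu + |∇u|²` gives the identity.
  let s : Space D → ℝ := fun y => (1 / 2) * inner ℝ (u y) (u y)
  have hsc : ContDiffOn ℝ 2 s (closure Ω) := contDiffOn_const.mul (hu.inner ℝ hu)
  have hgs : ContDiffOn ℝ 1 (grad Ω s) (closure Ω) := contDiffOn_grad hs hsc (by norm_num)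
  have hnorm : ∀ x n, IsOutwardUnitNormal Ω x n → inner ℝ (grad Ω s x) n = 0 := fun x n hxn => by
    have hx : x ∈ closure Ω := frontier_subset_closure hxn.1
    have h1 := (hu.differentiableOn (by simp) x hx).hasFDerivWithinAt
    have h2 := (h1.inner ℝ h1).const_mul (1 / 2)
    rw [inner_grad, h2.fderivWithin (hs x hx)]
    simp [h0 x n hxn]
  have hflux := integral_flux_eq_zero hΩ hgs hnorm (h := fun _ => 1) (h' := fun _ => 0)
    (fun x _ => hasGradientAt_const x 1) continuousOn_const (C := 1) (by simp) (by simp)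
  have hd : ∀ y ∈ Ω, HasFDerivAt u (fderiv ℝ u y) y := fun y hy =>
    ((hu.mono subset_closure).differentiableOn (by simp) y hy |>.differentiableAt
      (ho.mem_nhds hy)).hasFDerivAt
  have hs1 : ∀ y ∈ Ω, ∀ z, fderiv ℝ s y z = inner ℝ (u y) (fderiv ℝ u y z) := fun y hy z => by
    have h2 := ((hd y hy).inner ℝ (hd y hy)).const_mul (1 / 2)
    have h3 : fderiv ℝ s y = _ := h2.fderiv
    rw [h3]
    simp [real_inner_comm (u y)]
    ring
  have hpt : ∀ x ∈ Ω, divergence Ω (grad Ω s) x =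
      inner ℝ (u x) (lap Ω u x) + ∑ i, ∑ j, |partialDeriv Ω u i j x| ^ 2 := fun x hx => by
    have hux : ContDiffAt ℝ 2 u x := hu.contDiffAt (closure_mem_nhds ho hx)
    rw [divergence_eq_fdiv ho _ hx, fdiv_grad ho (hsc.mono subset_closure) hx,
      lap_eq_flap ho hs hux hx, flap, flap, inner_sum, Finset.sum_comm,
      ← Finset.sum_add_distrib]
    refine Finset.sum_congr rfl fun j _ => ?_
    have he : (fun y => fderiv ℝ s y (EuclideanSpace.single j 1)) =ᶠ[𝓝 x]
        fun y => inner ℝ (u y) (fderiv ℝ u y (EuclideanSpace.single j 1)) := by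
      filter_upwards [ho.mem_nhds hx] with y hy using hs1 y hy _
    have h1 : DifferentiableAt ℝ (fun y => fderiv ℝ u y (EuclideanSpace.single j 1)) x :=
      ((hux.fderiv_right (m := 1) (by norm_num)).clm_apply contDiffAt_const).differentiableAt
        (by simp)
    rw [he.fderiv_eq, fderiv_inner_apply ℝ (hd x hx).differentiableAt h1]
    congr 1
    simp only [partialDeriv, fderivWithin_of_mem_nhds (closure_mem_nhds ho hx), sq_abs]
    rw [real_inner_self_eq_norm_sq, EuclideanSpace.real_norm_sq_eq]
  have hpd : ∀ i j, ContinuousOn (fun x => |partialDeriv Ω u i j x| ^ 2) (closure Ω) :=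
    fun i j => by
      have h1 : ContinuousOn (partialDeriv Ω u i j) (closure Ω) :=
        (EuclideanSpace.proj (𝕜 := ℝ) i).continuous.comp_continuousOn
          ((hu.continuousOn_fderivWithin hs (by norm_num)).clm_apply continuousOn_const)
      exact h1.abs.pow 2
  have hI1 : IntegrableOn (fun x => inner ℝ (u x) (lap Ω u x)) Ω :=
    hΩ.integrableOn_of_continuousOn_closure (hu.continuousOn.inner (continuousOn_lap hs hu))
  have hI2 : ∀ i j, IntegrableOn (fun x => |partialDeriv Ω u i j x| ^ 2) Ω := fun i j =>
    hΩ.integrableOn_of_continuousOn_closure (hpd i j)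
  have hgn : gradNormSq Ω u = ∫ x in Ω, ∑ i, ∑ j, |partialDeriv Ω u i j x| ^ 2 := by
    rw [integral_finsetSum _ fun i _ => integrable_finsetSum _ fun j _ => hI2 i j]
    refine Finset.sum_congr rfl fun i _ => ?_
    rw [integral_finsetSum _ fun j _ => hI2 i j]
  rw [eq_neg_iff_add_eq_zero, hgn, ← integral_add hI1
    (integrable_finsetSum _ fun i _ => integrable_finsetSum _ fun j _ => hI2 i j), ← hflux]
  refine setIntegral_congr_fun hms fun x hx => ?_
  simp only [inner_zero_left, zero_add, one_mul]
  exact (hpt x hx).symm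

/-! ### Consequences of the GePUP-ES equations -/

section Solutions

variable {J : Set ℝ} {t₀ ν lam : ℝ} {g w u : ℝ → Space D → Space D} {q : ℝ → Space D → ℝ}
  {r : ℝ → ℝ}

/-- The right-hand side of the momentum equation. -/
def momentumRHS (Ω : Set (Space D)) (ν : ℝ) (g w u : ℝ → Space D → Space D)
    (q : ℝ → Space D → ℝ) (r : ℝ → ℝ) (t : ℝ) (x : Space D) : Space D :=
  g t x - r t • convection Ω (u t) x - grad Ω (q t) x + ν • lap Ω (w t) x

theorem continuousOn_momentumRHS (hΩ : IsLipschitzDomain Ω) (hreg : IsClassical Ω J g w u q)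
    {t : ℝ} (ht : t ∈ J) : ContinuousOn (momentumRHS Ω ν g w u q r t) (closure Ω) := by
  have hs := hΩ.uniqueDiffOn_closure
  have h1 := (contDiffOn_convection hs (contDiffOn_slice hreg.u_reg ht)).continuousOn
  have h2 := (contDiffOn_grad (m := 0) hs (hreg.q_reg t ht) (by norm_num)).continuousOn
  have h3 := continuousOn_lap hs (contDiffOn_slice hreg.w_reg ht)
  have h4 : ContinuousOn (fun x => r t • convection Ω (u t) x) (closure Ω) := h1.const_smul (r t)
  have h5 : ContinuousOn (fun x => ν • lap Ω (w t) x) (closure Ω) := h3.const_smul ν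
  have h6 := hreg.g_reg t ht
  unfold momentumRHS
  fun_prop

/-- The momentum equation holds up to the boundary. -/
theorem timeDeriv_eq_momentumRHS (hΩ : IsLipschitzDomain Ω) (hJ : UniqueDiffOn ℝ J)
    (hreg : IsClassical Ω J g w u q) (hsol : IsGePUPES Ω J ν lam g w u q r) {t : ℝ} (ht : t ∈ J) :
    EqOn (timeDeriv J (closure Ω) w t) (momentumRHS Ω ν g w u q r t) (closure Ω) := by
  have hΩeq : EqOn (timeDeriv J (closure Ω) w t) (momentumRHS Ω ν g w u q r t) Ω := fun x hx =>
    (hJ t ht).eq_deriv J (hasDerivWithinAt_timeDeriv (hreg.w_reg.differentiableOn (by simp)) ht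
      (subset_closure hx)) (hsol.momentum t ht x hx)
  exact hΩeq.of_subset_closure
    (contDiffOn_slice (contDiffOn_timeDeriv hJ hΩ.uniqueDiffOn_closure hreg.w_reg) ht).continuousOn
    (continuousOn_momentumRHS hΩ hreg ht) subset_closure Subset.rfl

/-- The velocity `w` stays solenoidal, its divergence being a solution of the heat equation. -/
theorem divergence_eq_zero (hΩ : IsLipschitzDomain Ω) (hJo : J.OrdConnected)
    (hJ : UniqueDiffOn ℝ J) (hJi : J ⊆ closure (interior J)) (ht₀ : IsLeast J t₀) (hν : 0 < ν)
    (hreg : IsClassical Ω J g w u q) (hsol : IsGePUPES Ω J ν lam g w u q r)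
    (hinit : ∀ x ∈ closure Ω, w t₀ x = u t₀ x) {t : ℝ} (ht : t ∈ J) :
    ∀ x ∈ closure Ω, divergence Ω (w t) x = 0 := by
  have ho := hΩ.isOpen
  have hs := hΩ.uniqueDiffOn_closure
  have hsub : Icc t₀ t ⊆ J := hJo.out ht₀.1 ht
  have hdiv : ∀ s, ∀ x ∈ Ω, divergence Ω (w s) =ᶠ[𝓝 x] fdiv (w s) := fun s x hx => by
    filter_upwards [ho.mem_nhds hx] with y hy using divergence_eq_fdiv ho _ hy
  refine heat_eq_zero ho hΩ.isCompact_closure hν (f := fun s => divergence Ω (w s)) (t₀ := t₀)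
    (T := t) ?_ ?_ (fun s hs' x hx => hsol.div_boundary s (hsub hs') x hx) ?_ ?_ t
    ⟨ht₀.2 ht, le_rfl⟩
  · refine continuousOn_finsetSum _ fun i _ => ?_
    exact (EuclideanSpace.proj (𝕜 := ℝ) i).continuous.comp_continuousOn
      ((continuousOn_fderivWithin_slice hJ hs hreg.w_reg _).mono (prod_mono hsub Subset.rfl))
  -- Initially `w = u`, which is solenoidal inside `Ω`; on the boundary the imposed condition on
  -- `∇·w` applies.
  · intro x hx
    by_cases hxΩ : x ∈ Ω
    · rw [← (hsol.projection t₀ ht₀.1).1 x hxΩ]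
      simp only [divergence, partialDeriv, fderivWithin_congr hinit (hinit x hx)]
    · exact hsol.div_boundary t₀ ht₀.1 x (by rw [ho.frontier_eq]; exact ⟨hx, hxΩ⟩)
  · intro s hs' x hx
    exact ((contDiffOn_fdiv ho (hreg.w_interior s (hsub hs')) (by norm_num)).contDiffAt
      (ho.mem_nhds hx)).congr_of_eventuallyEq (hdiv s x hx)
  · intro s hs' x hx
    have hsJ := hsub hs'
    have hder : HasDerivWithinAt (fun s => divergence Ω (w s) x)
        (divergence Ω (timeDeriv J (closure Ω) w s) x) J s :=
      HasDerivWithinAt.fun_sum fun i _ =>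
        ((EuclideanSpace.proj (𝕜 := ℝ) i).hasFDerivAt.comp_hasDerivWithinAt s
          (hasDerivWithinAt_fderivWithin_slice hJ hs hJi (subset_closure_interior_closure ho)
            hreg.w_reg hsJ (subset_closure hx) (EuclideanSpace.single i 1)))
    have heq : timeDeriv J (closure Ω) w s =ᶠ[𝓝 x] momentumRHS Ω ν g w u q r s := by
      filter_upwards [ho.mem_nhds hx] with y hy
      exact timeDeriv_eq_momentumRHS hΩ hJ hreg hsol hsJ (subset_closure hy)
    have hval : divergence Ω (timeDeriv J (closure Ω) w s) x = ν * flap (divergence Ω (w s)) x := by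
      rw [divergence_eq_fdiv ho _ hx, fdiv_congr heq, flap_congr (hdiv s x hx)]
      exact fdiv_momentum hΩ (hreg.g_interior s hsJ) (contDiffOn_slice hreg.u_reg hsJ)
        (hreg.w_interior s hsJ) (hreg.q_interior s hsJ) hx (hsol.pressure s hsJ x hx)
    rw [← hval]
    exact hder.mono hsub

/-- The velocity `w` satisfies the no-slip condition. -/
theorem eq_zero_of_isOutwardUnitNormal (hΩ : IsLipschitzDomain Ω) (hJo : J.OrdConnected)
    (hJ : UniqueDiffOn ℝ J) (ht₀ : IsLeast J t₀)
    (hreg : IsClassical Ω J g w u q) (hsol : IsGePUPES Ω J ν lam g w u q r)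
    (hinit : ∀ x ∈ closure Ω, w t₀ x = u t₀ x) {t : ℝ} (ht : t ∈ J) {x n : Space D}
    (hn : IsOutwardUnitNormal Ω x n) : w t x = 0 := by
  have hx : x ∈ closure Ω := frontier_subset_closure hn.1
  -- The momentum equation on the boundary and the pressure boundary condition give `(n·w)' = -λ
  -- n·w`; the exponential is its integrating factor.
  have hder : ∀ s ∈ J, HasDerivWithinAt (fun s => inner ℝ n (w s x) * Real.exp (lam * s)) 0 J s := by
    intro s hsJ
    have h1 := hasDerivWithinAt_timeDeriv (hreg.w_reg.differentiableOn (by simp)) hsJ hx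
    rw [timeDeriv_eq_momentumRHS hΩ hJ hreg hsol hsJ hx] at h1
    have h2 : HasDerivWithinAt (fun s => inner ℝ n (w s x))
        (inner ℝ n (momentumRHS Ω ν g w u q r s x)) J s :=
      (innerSL ℝ n).hasFDerivAt.comp_hasDerivWithinAt s h1
    have h3 : inner ℝ n (momentumRHS Ω ν g w u q r s x) = -(lam * inner ℝ n (w s x)) := by
      have h4 := hsol.pressure_boundary s hsJ x n hn
      have h5 : momentumRHS Ω ν g w u q r s x = (g s x - r s • convection Ω (u s) x +
          ν • lap Ω (w s) x) - grad Ω (q s) x := by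
        simp only [momentumRHS]; abel
      rw [h5, inner_sub_right, h4]; ring
    have h6 : HasDerivWithinAt (fun s => Real.exp (lam * s)) (Real.exp (lam * s) * lam) J s := by
      simpa using (((hasDerivAt_id s).const_mul lam).exp).hasDerivWithinAt
    refine (h2.mul h6).congr_deriv ?_
    rw [h3]; ring
  have hconst : inner ℝ n (w t x) * Real.exp (lam * t) =
      inner ℝ n (w t₀ x) * Real.exp (lam * t₀) := by
    have hconv : Convex ℝ J := hJo.convex
    have := Convex.norm_image_sub_le_of_norm_hasDerivWithin_le (C := 0) hder (by simp) hconv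
      ht₀.1 ht
    rw [zero_mul, norm_le_zero_iff, sub_eq_zero] at this
    exact this
  have hnw : inner ℝ n (w t x) = 0 := by
    rw [hinit x hx, real_inner_comm (u t₀ x), hsol.no_penetration t₀ ht₀.1 x n hn, zero_mul] at hconst
    exact (mul_eq_zero.1 hconst).resolve_right (Real.exp_pos _).ne'
  -- With no normal component, `w t x` is itself a tangent vector, so it may be tested against
  -- itself.
  have := hsol.tangential t ht x n (w t x) hn (by rw [real_inner_comm]; exact hnw)
  exact inner_self_eq_zero.1 this

/-- The two velocities coincide. -/
theorem w_eq_u (hΩ : IsLipschitzDomain Ω) (hJo : J.OrdConnected)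
    (hJ : UniqueDiffOn ℝ J) (hJi : J ⊆ closure (interior J)) (ht₀ : IsLeast J t₀) (hν : 0 < ν)
    (hreg : IsClassical Ω J g w u q) (hsol : IsGePUPES Ω J ν lam g w u q r)
    (hinit : ∀ x ∈ closure Ω, w t₀ x = u t₀ x) {t : ℝ} (ht : t ∈ J) :
    ∀ x ∈ closure Ω, w t x = u t x := by
  have ho := hΩ.isOpen
  have hw : ContDiffOn ℝ 1 (w t) (closure Ω) :=
    (contDiffOn_slice hreg.w_reg ht).of_le (by norm_num)
  have hu : ContDiffOn ℝ 1 (u t) (closure Ω) :=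
    (contDiffOn_slice hreg.u_reg ht).of_le (by norm_num)
  obtain ⟨hdivu, φ, hφ⟩ := hsol.projection t ht
  have hd : ∀ {v : Space D → Space D}, ContDiffOn ℝ 1 v (closure Ω) → ∀ x ∈ Ω,
      DifferentiableAt ℝ v x := fun hv x hx =>
    (hv.contDiffAt (closure_mem_nhds ho hx)).differentiableAt (by simp)
  have h0 := eq_zero_of_solenoidal_gradient hΩ (v := fun x => w t x - u t x) (hw.sub hu)
    (fun x hx => by
      rw [divergence_eq_fdiv ho _ hx, fdiv_sub (hd hw x hx) (hd hu x hx),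
        ← divergence_eq_fdiv ho _ hx, ← divergence_eq_fdiv ho _ hx, hdivu x hx,
        divergence_eq_zero hΩ hJo hJ hJi ht₀ hν hreg hsol hinit ht x (subset_closure hx), sub_zero])
    (fun x n hn => by
      rw [inner_sub_left, hsol.no_penetration t ht x n hn,
        eq_zero_of_isOutwardUnitNormal hΩ hJo hJ ht₀ hreg hsol hinit ht hn, inner_zero_left,
        sub_zero]) hφ
  exact fun x hx => sub_eq_zero.1 (h0 x hx)

/-- The energy balance of the momentum equation. -/
theorem integral_inner_momentumRHS (hΩ : IsLipschitzDomain Ω) (hreg : IsClassical Ω J g w u q)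
    {t : ℝ} (ht : t ∈ J) (hwu : ∀ x ∈ closure Ω, w t x = u t x)
    (hdiv : ∀ x ∈ Ω, divergence Ω (u t) x = 0)
    (hn : ∀ x n, IsOutwardUnitNormal Ω x n → u t x = 0) (hg : IsConservative Ω (g t)) :
    ∫ x in Ω, inner ℝ (u t x) (momentumRHS Ω ν g w u q r t x) =
      -r t * Icv Ω (u t) (u t) - ν * gradNormSq Ω (u t) := by
  have ho := hΩ.isOpen
  have hs := hΩ.uniqueDiffOn_closure
  have hu := contDiffOn_slice hreg.u_reg ht
  obtain ⟨ϕ, hϕ⟩ := hg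
  have hgrad : ContinuousOn (grad Ω (q t)) (closure Ω) :=
    (contDiffOn_grad (m := 0) hs (hreg.q_reg t ht) (by norm_num)).continuousOn
  have hGc : ContinuousOn (fun x => -g t x + grad Ω (q t) x) (closure Ω) :=
    (hreg.g_reg t ht).neg.add hgrad
  -- Since `g` is conservative, force and pressure combine into the single gradient `∇(ϕ + q)`,
  -- orthogonal to `u`.
  have h1 : ∫ x in Ω, inner ℝ (-g t x + grad Ω (q t) x) (u t x) = 0 := by
    refine integral_inner_gradient_eq_zero hΩ (hu.of_le (by norm_num)) hdiv
      (fun x n hxn => by rw [hn x n hxn, inner_zero_left]) (p := fun x => ϕ x + q t x)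
      (fun x hx => ?_) hGc
    have hq := hasGradientAt_grad ho hx (((hreg.q_interior t ht).contDiffAt
      (ho.mem_nhds hx)).differentiableAt (by simp))
    rw [hasGradientAt_iff_hasFDerivAt, map_add]
    exact (hϕ x hx).hasFDerivAt.add hq.hasFDerivAt
  have h2 := integral_inner_lap hΩ hu hn
  have i1 : IntegrableOn (fun x => inner ℝ (-g t x + grad Ω (q t) x) (u t x)) Ω :=
    hΩ.integrableOn_of_continuousOn_closure (hGc.inner hu.continuousOn)
  have i2 : IntegrableOn (fun x => inner ℝ (convection Ω (u t) x) (u t x)) Ω :=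
    hΩ.integrableOn_of_continuousOn_closure
      ((contDiffOn_convection hs hu).continuousOn.inner hu.continuousOn)
  have i3 : IntegrableOn (fun x => inner ℝ (u t x) (lap Ω (u t) x)) Ω :=
    hΩ.integrableOn_of_continuousOn_closure (hu.continuousOn.inner (continuousOn_lap hs hu))
  have hpt : ∀ x ∈ Ω, inner ℝ (u t x) (momentumRHS Ω ν g w u q r t x) =
      ν * inner ℝ (u t x) (lap Ω (u t) x) - r t * inner ℝ (convection Ω (u t) x) (u t x) -
        inner ℝ (-g t x + grad Ω (q t) x) (u t x) := fun x hx => by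
    have hlap : lap Ω (w t) x = lap Ω (u t) x :=
      (InnerProductSpace.laplacianWithin_congr_nhdsWithin
        (eventually_of_mem self_mem_nhdsWithin hwu) hs).self_of_nhdsWithin (subset_closure hx)
    simp only [momentumRHS, hlap, inner_add_right, inner_sub_right, inner_smul_right,
      real_inner_comm (u t x), inner_neg_right]
    ring
  have i4 : IntegrableOn (fun x => ν * inner ℝ (u t x) (lap Ω (u t) x) -
      r t * inner ℝ (convection Ω (u t) x) (u t x)) Ω := (i3.const_mul ν).sub (i2.const_mul (r t))
  rw [setIntegral_congr_fun ho.measurableSet hpt, integral_sub i4 i1, integral_sub (i3.const_mul ν) (i2.const_mul (r t)), h1,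
    integral_const_mul, integral_const_mul, h2, Icv]
  ring

end Solutions

end GePUP

end

/-! ### The energy identity -/

theorem mainTheorem6 {D : ℕ} (Ω : Set (GePUP.Space D)) (hΩ : GePUP.IsLipschitzDomain Ω)
    (J : Set ℝ) (t₀ : ℝ) (hJ : J.OrdConnected) (ht₀ : IsLeast J t₀)
    (ν lam : ℝ) (hν : 0 < ν) (hlam : 0 ≤ lam)
    (g w u : ℝ → GePUP.Space D → GePUP.Space D) (q : ℝ → GePUP.Space D → ℝ) (r : ℝ → ℝ)
    (hreg : GePUP.IsClassical Ω J g w u q)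
    (hsol : GePUP.IsGePUPES Ω J ν lam g w u q r)
    (hinit : ∀ x ∈ closure Ω, w t₀ x = u t₀ x)
    (hg : ∀ t ∈ J, GePUP.IsConservative Ω (g t)) :
    ∀ t ∈ J, HasDerivWithinAt (fun s => GePUP.kineticEnergy Ω (u s) + r s ^ 2 / 2)
      (-ν * GePUP.gradNormSq Ω (u t)) J t := by
  intro t ht
  rcases J.subsingleton_or_nontrivial with hsub | hnt
  -- If `J` is a single point, every value is a derivative within `J`.
  · exact hasDerivWithinAt_iff_hasFDerivWithinAt.2 (.of_subsingleton hsub)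
  obtain ⟨hJU, hJi⟩ := GePUP.uniqueDiffOn_of_ordConnected hJ hnt
  have hwu : ∀ s ∈ J, ∀ x ∈ closure Ω, w s x = u s x := fun s hs =>
    GePUP.w_eq_u hΩ hJ hJU hJi ht₀ hν hreg hsol hinit hs
  have hs := hΩ.uniqueDiffOn_closure
  have hud : DifferentiableOn ℝ (fun p : ℝ × GePUP.Space D => u p.1 p.2) (J ×ˢ closure Ω) :=
    hreg.u_reg.differentiableOn (by simp)
  have huc := hreg.u_reg.continuousOn
  have htc := (GePUP.contDiffOn_timeDeriv hJU hs hreg.u_reg).continuousOn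
  have hE : HasDerivWithinAt (fun s => ∫ x in Ω, inner ℝ (u s x) (u s x))
      (∫ x in Ω, 2 * inner ℝ (u t x) (GePUP.timeDeriv J (closure Ω) u t x)) J t := by
    refine GePUP.hasDerivWithinAt_setIntegral hΩ hJ ht₀ (f := fun s x => inner ℝ (u s x) (u s x))
      (f' := fun s x => 2 * inner ℝ (u s x) (GePUP.timeDeriv J (closure Ω) u s x))
      (huc.inner huc) (continuousOn_const.mul (huc.inner htc)) (fun s hsJ x hx => ?_) ht
    have h1 := GePUP.hasDerivWithinAt_timeDeriv hud hsJ (subset_closure hx)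
    refine (h1.inner ℝ h1).congr_deriv ?_
    rw [real_inner_comm (u s x)]; ring
  -- Because `u` and `w` agree throughout `J`, the time derivative of `u` is the right-hand side of
  -- the equation for `w`.
  have hut : ∀ x ∈ Ω, GePUP.timeDeriv J (closure Ω) u t x =
      GePUP.momentumRHS Ω ν g w u q r t x := fun x hx =>
    (hJU t ht).eq_deriv J (GePUP.hasDerivWithinAt_timeDeriv hud ht (subset_closure hx))
      ((hsol.momentum t ht x hx).congr (fun s hsJ => (hwu s hsJ x (subset_closure hx)).symm)
        (hwu t ht x (subset_closure hx)).symm)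
  have hbal := GePUP.integral_inner_momentumRHS (ν := ν) (r := r) hΩ hreg ht (hwu t ht)
    (hsol.projection t ht).1 (fun x n hn => by
      rw [← hwu t ht x (frontier_subset_closure hn.1)]
      exact GePUP.eq_zero_of_isOutwardUnitNormal hΩ hJ hJU ht₀ hreg hsol hinit ht hn) (hg t ht)
  -- This contributes `r I_cv(u, u)`, exactly opposite to the convective term in `hbal`.
  have hr := ((hsol.sav t ht).pow 2).div_const 2
  refine ((hE.const_mul (1 / 2)).add hr).congr_deriv ?_
  rw [MeasureTheory.integral_const_mul, MeasureTheory.setIntegral_congr_fun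
    hΩ.isOpen.measurableSet (g := fun x => inner ℝ (u t x) (GePUP.momentumRHS Ω ν g w u q r t x))
    (fun x hx => by simp only [hut x hx]), hbal]
  push_cast
  ring
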